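/- Let $G$ be a finite non-abelian group with identity $e$, let $m>1$ be an integer, and write $\mathbf e=(e,\dots,e)\in G^m$. For $x\in G$ and $1\le k<l\le m+1$ let $\mathbf x_{[k,l)}\in G^m$ be the tuple whose $i$-th entry is $x$ if $k\le i<l$ and $e$ otherwise. Call $[k,l)_G=\{\mathbf x_{[k,l)} : x\in G\setminus\{e\}\}$ an interval, let $\mathcal S\subset G^m$ be the union of all intervals, and let $\mathscr G_m(G)$ be the Cayley graph with vertex set $G^m$ in which $\mathbf g\sim\mathbf h$ if and only if $\mathbf h=\mathbf s\,\mathbf g$ for some $\mathbf s\in\mathcal S$. In its automorphism group $\mathbf{Aut}(\mathscr G_m(G))$ let - $\mathbf T_m$ be the group of right translations $\mathbf x\mapsto\mathbf x\mathbf g$, $\mathbf g\in G^m$; - $\mathbf{Aut}_m(G)$ be the group of homogeneous automorphisms, that is, those that fix $\mathbf e$ and map every interval onto itself; - $\mathbf\Delta_m=\langle\tau,\omega\rangle$, where $\tau(g_1,\dots,g_m)=(g_m,\dots,g_1)$ and $\omega(g_1,\dots,g_m)=(g_1^{-1}g_2,g_1^{-1}g_3,\dots,g_1^{-1}g_m,g_1^{-1})$.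 Let $D_{m+1}$ be the dihedral group of order $2m+2$, generated by a rotation $\rho$ of order $m+1$ and a reflection $\sigma$. Then $\mathbf{Aut}_m(G)$ consists exactly of the maps $\hat f:(x_1,\dots,x_m)\mapsto(f(x_1),\dots,f(x_m))$ with $f\in\mathbf{Aut}(G)$, and the following hold. 1. The stabilizer of $\mathbf e$ in $\mathbf{Aut}(\mathscr G_m(G))$ is the internal direct product $\mathbf{Aut}_m(G)\times\mathbf\Delta_m$, and it is isomorphic to $\mathbf{Aut}(G)\times D_{m+1}$ by an isomorphism under which $f\in\mathbf{Aut}(G)$ corresponds to $\hat f$, $\rho$ to $\omega$, and $\sigma$ to $\tau$. 2. $\mathbf{Aut}(\mathscr G_m(G))=\big(\mathbf T_m\rtimes\mathbf{Aut}_m(G)\big)\rtimes\mathbf\Delta_m$ as an iterated internal semidirect product. Consequently $\mathbf{Aut}(\mathscr G_m(G))\simeq\big(G^m\rtimes\mathbf{Aut}(G)\big)\rtimes D_{m+1}$, where $\mathbf{Aut}(G)$ acts coordinatewise on $G^m$ and $D_{m+1}$ acts on $G^m\rtimes\mathbf{Aut}(G)$ in the way determined by the internal decomposition. Explicitly, for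 some action of $D_{m+1}$ on $G^m\rtimes\mathbf{Aut}(G)$ there is an isomorphism from $\big(G^m\rtimes\mathbf{Aut}(G)\big)\rtimes D_{m+1}$ onto $\mathbf{Aut}(\mathscr G_m(G))$ (with product $\alpha\beta=\alpha\circ\beta$) that sends $\mathbf g\in G^m$ to $\mathbf x\mapsto\mathbf x\mathbf g^{-1}$, $f\in\mathbf{Aut}(G)$ to $\hat f$, $\rho$ to $\omega$, and $\sigma$ to $\tau$. -/

import Mathlib

namespace GenericCayley

variable {G : Type*} [Group G] {m : ℕ}

/-- The element `x_{[k,l)}` of `G ^ m`. Coordinates are numbered `0, …, m - 1`, so the element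
`x_{[k,l)}` in the numbering `1, …, m`, where `1 ≤ k < l ≤ m + 1`, is `block m (k-1) (l-1) x`. -/
def block (m k l : ℕ) (x : G) : Fin m → G :=
  fun i => if k ≤ (i : ℕ) ∧ (i : ℕ) < l then x else 1

variable (G m) in
/-- The interval consisting of all `x_{[k,l)}` with `x ≠ e`. -/
def interval (k l : ℕ) : Set (Fin m → G) :=
  {g | ∃ x : G, x ≠ 1 ∧ g = block m k l x}

variable (G m) in
/-- The canonical symmetric subset `𝒮` of `G ^ m`: the union of all intervals. -/
def canonicalSet : Set (Fin m → G) :=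
  {g | ∃ k l : ℕ, k < l ∧ l ≤ m ∧ g ∈ interval G m k l}

theorem block_mul (k l : ℕ) (x y : G) : block m k l x * block m k l y = block m k l (x * y) := by
  funext i
  simp only [block, Pi.mul_apply]
  split_ifs <;> simp

theorem block_one (k l : ℕ) : block m k l (1 : G) = 1 := by
  funext i
  simp [block]

theorem one_notMem_canonicalSet : (1 : Fin m → G) ∉ canonicalSet G m := by
  rintro ⟨k, l, hkl, hl, x, hx, h⟩
  have := congrFun h ⟨k, by omega⟩
  simp [block, hkl] at this
  exact hx this.symm

theorem inv_mem_canonicalSet {s : Fin m → G} (hs : s ∈ canonicalSet G m) :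
    s⁻¹ ∈ canonicalSet G m := by
  obtain ⟨k, l, hkl, hl, x, hx, rfl⟩ := hs
  refine ⟨k, l, hkl, hl, x⁻¹, by simpa using hx, ?_⟩
  rw [inv_eq_iff_mul_eq_one, block_mul, mul_inv_cancel, block_one]

variable (G m) in
/-- The Cayley graph `𝒢_m(G) = Cay(G ^ m, 𝒮)`: `g ∼ h` iff `h = s * g` for some `s ∈ 𝒮`. -/
def cayleyGraph : SimpleGraph (Fin m → G) where
  Adj g h := ∃ s ∈ canonicalSet G m, h = s * g
  symm := ⟨by
    rintro g h ⟨s, hs, rfl⟩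
    exact ⟨s⁻¹, inv_mem_canonicalSet hs, by simp⟩⟩
  loopless := ⟨by
    rintro g ⟨s, hs, h⟩
    exact one_notMem_canonicalSet (by rwa [right_eq_mul.mp h] at hs)⟩

theorem adj_iff {g h : Fin m → G} : (cayleyGraph G m).Adj g h ↔
    ∃ k l : ℕ, k < l ∧ l ≤ m ∧ ∃ x : G, x ≠ 1 ∧ h = block m k l x * g := by
  constructor
  · rintro ⟨s, ⟨k, l, hkl, hl, x, hx, rfl⟩, h⟩
    exact ⟨k, l, hkl, hl, x, hx, h⟩
  · rintro ⟨k, l, hkl, hl, x, hx, h⟩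
    exact ⟨_, ⟨k, l, hkl, hl, x, hx, rfl⟩, h⟩

variable (G m) in
/-- The automorphism group of the graph `𝒢_m(G)`; the product `α * β` is `α ∘ β`. -/
abbrev GraphAut : Type _ := cayleyGraph G m ≃g cayleyGraph G m

/-- A bijection of `G ^ m` which, together with its inverse, preserves adjacency. -/
def mkAut (e : (Fin m → G) ≃ (Fin m → G))
    (h₁ : ∀ g h, (cayleyGraph G m).Adj g h → (cayleyGraph G m).Adj (e g) (e h))
    (h₂ : ∀ g h, (cayleyGraph G m).Adj g h → (cayleyGraph G m).Adj (e.symm g) (e.symm h)) :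
    GraphAut G m where
  toEquiv := e
  map_rel_iff' := by
    intro g h
    exact ⟨fun H => by simpa using h₂ _ _ H, h₁ g h⟩

/-! ### Right translations -/

theorem adj_mul_right (a g h : Fin m → G) (H : (cayleyGraph G m).Adj g h) :
    (cayleyGraph G m).Adj (g * a) (h * a) := by
  obtain ⟨s, hs, rfl⟩ := H
  exact ⟨s, hs, mul_assoc _ _ _⟩

variable (G m) in
/-- The homomorphism that sends `a ∈ G ^ m` to the right translation `x ↦ x * a⁻¹`. -/
def translation : (Fin m → G) →* GraphAut G m where
  toFun a := mkAut (Equiv.mulRight a⁻¹) (fun _ _ => adj_mul_right _ _ _)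
    (fun _ _ => adj_mul_right _ _ _)
  map_one' := RelIso.ext fun x => by
    change x * 1⁻¹ = x
    simp
  map_mul' a b := RelIso.ext fun x => by
    change x * (a * b)⁻¹ = x * b⁻¹ * a⁻¹
    simp [mul_assoc]

@[simp] theorem translation_apply (a x : Fin m → G) : translation G m a x = x * a⁻¹ := rfl

variable (G m) in
/-- The group `𝐓_m(G)` of all right translations of `G ^ m`. -/
def translationGroup : Subgroup (GraphAut G m) := (translation G m).range

/-! ### Automorphisms of `G` acting coordinatewise, homogeneous automorphisms -/

variable (G m) in
/-- `Aut(G)` acts on `G ^ m` coordinatewise. -/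
def coordAction : MulAut G →* MulAut (Fin m → G) where
  toFun f := MulEquiv.piCongrRight fun _ => f
  map_one' := rfl
  map_mul' _ _ := rfl

@[simp] theorem coordAction_apply (f : MulAut G) (x : Fin m → G) (i : Fin m) :
    coordAction G m f x i = f (x i) := rfl

theorem adj_coord (f : MulAut G) (g h : Fin m → G) (H : (cayleyGraph G m).Adj g h) :
    (cayleyGraph G m).Adj (coordAction G m f g) (coordAction G m f h) := by
  obtain ⟨k, l, hkl, hl, x, hx, rfl⟩ := adj_iff.mp H
  refine adj_iff.mpr ⟨k, l, hkl, hl, f x, by simpa using hx, ?_⟩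
  rw [map_mul]
  congr 1
  funext i
  simp only [coordAction_apply, block]
  split_ifs <;> simp

variable (G m) in
/-- The homomorphism `Aut(G) → Aut(𝒢_m(G))` that sends `f` to
`(x_1, …, x_m) ↦ (f(x_1), …, f(x_m))`. -/
def coordAut : MulAut G →* GraphAut G m where
  toFun f := mkAut (coordAction G m f).toEquiv (adj_coord f) (adj_coord f⁻¹)
  map_one' := rfl
  map_mul' _ _ := rfl

@[simp] theorem coordAut_apply (f : MulAut G) (x : Fin m → G) (i : Fin m) :
    coordAut G m f x i = f (x i) := rfl

variable (G m) in
/-- The group `𝐀𝐮𝐭_m(G)` of homogeneous automorphisms of `𝒢_m(G)`: those that fix the identity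
vertex and map each interval onto itself. -/
def homogeneousAut : Subgroup (GraphAut G m) where
  carrier := {F | F 1 = 1 ∧ ∀ k l : ℕ, k < l → l ≤ m → F '' interval G m k l = interval G m k l}
  one_mem' := ⟨rfl, fun k l _ _ => Set.image_id _⟩
  mul_mem' := by
    rintro F H ⟨hF, hF'⟩ ⟨hH, hH'⟩
    refine ⟨?_, fun k l hkl hl => ?_⟩
    · rw [RelIso.mul_apply, hH, hF]
    · rw [RelIso.coe_mul, Set.image_comp, hH' k l hkl hl, hF' k l hkl hl]
  inv_mem' := by
    rintro F ⟨hF, hF'⟩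
    have key : ∀ x, F⁻¹ (F x) = x := fun x => F.symm_apply_apply x
    refine ⟨?_, fun k l hkl hl => ?_⟩
    · conv_lhs => rw [← hF, key]
    · conv_lhs => rw [← hF' k l hkl hl, ← Set.image_comp]
      have : (⇑F⁻¹ ∘ ⇑F) = id := funext key
      rw [this, Set.image_id]

/-! ### The automorphisms `τ` and `ω` -/

/-- `(g_1, …, g_m) ↦ (g_m, …, g_1)`. -/
def tauFun (g : Fin m → G) : Fin m → G := fun i => g i.rev

/-- The tuple `g ∈ G ^ m` prolonged by the value `1` after its last coordinate. -/
def prolong (g : Fin m → G) (i : ℕ) : G := if h : i < m then g ⟨i, h⟩ else 1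

/-- `(g_1, …, g_m) ↦ (g_1⁻¹ g_2, g_1⁻¹ g_3, …, g_1⁻¹ g_m, g_1⁻¹)`: the coordinate after
the last one is read as `1`. -/
def omegaFun (g : Fin m → G) : Fin m → G := fun i => (prolong g 0)⁻¹ * prolong g (i + 1)

theorem prolong_of_lt (g : Fin m → G) {i : ℕ} (h : i < m) : prolong g i = g ⟨i, h⟩ := dif_pos h

theorem prolong_of_ge (g : Fin m → G) {i : ℕ} (h : m ≤ i) : prolong g i = 1 := dif_neg (by omega)

theorem tauFun_tauFun (g : Fin m → G) : tauFun (tauFun g) = g := by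
  funext i
  simp [tauFun]

theorem adj_tauFun (g h : Fin m → G) (H : (cayleyGraph G m).Adj g h) :
    (cayleyGraph G m).Adj (tauFun g) (tauFun h) := by
  obtain ⟨k, l, hkl, hl, x, hx, rfl⟩ := adj_iff.mp H
  refine adj_iff.mpr ⟨m - l, m - k, by omega, by omega, x, hx, ?_⟩
  funext i
  have hi := i.isLt
  have : (k ≤ m - (i + 1 : ℕ) ∧ m - (i + 1 : ℕ) < l) ↔ (m - l ≤ (i : ℕ) ∧ (i : ℕ) < m - k) := by
    omega
  simp [tauFun, block, Fin.val_rev, this]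

theorem prolong_block_mul {k l : ℕ} (hl : l ≤ m) (x : G) (g : Fin m → G) (i : ℕ) :
    prolong (block m k l x * g) i = (if k ≤ i ∧ i < l then x else 1) * prolong g i := by
  by_cases hi : i < m
  · simp [prolong_of_lt _ hi, block]
  · have : ¬ (k ≤ i ∧ i < l) := by omega
    simp [prolong_of_ge _ (not_lt.mp hi), this]

theorem adj_omegaFun (g h : Fin m → G) (H : (cayleyGraph G m).Adj g h) :
    (cayleyGraph G m).Adj (omegaFun g) (omegaFun h) := by
  obtain ⟨k, l, hkl, hl, x, hx, rfl⟩ := adj_iff.mp H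
  rcases Nat.eq_zero_or_pos k with rfl | hk
  · refine adj_iff.mpr ⟨l - 1, m, by omega, le_rfl, (prolong g 0)⁻¹ * x⁻¹ * prolong g 0, ?_, ?_⟩
    · intro h
      apply hx
      have h' : x⁻¹ = 1 := by
        calc x⁻¹ = prolong g 0 * ((prolong g 0)⁻¹ * x⁻¹ * prolong g 0) * (prolong g 0)⁻¹ := by group
          _ = 1 := by rw [h]; group
      simpa using h'
    · funext i
      have hi := i.isLt
      simp only [omegaFun, prolong_block_mul hl, Pi.mul_apply, block]
      have h0 : (0 ≤ 0 ∧ 0 < l) := by omega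
      rw [if_pos h0]
      by_cases hc : (i : ℕ) + 1 < l
      · rw [if_pos (by omega), if_neg (by omega)]
        group
      · rw [if_neg (by omega), if_pos (by omega)]
        group
  · refine adj_iff.mpr ⟨k - 1, l - 1, by omega, by omega, (prolong g 0)⁻¹ * x * prolong g 0, ?_, ?_⟩
    · intro h
      apply hx
      calc x = prolong g 0 * ((prolong g 0)⁻¹ * x * prolong g 0) * (prolong g 0)⁻¹ := by group
        _ = 1 := by rw [h]; group
    · funext i
      simp only [omegaFun, prolong_block_mul hl, Pi.mul_apply, block]
      have h0 : ¬ (k ≤ 0 ∧ 0 < l) := by omega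
      rw [if_neg h0]
      by_cases hc : k ≤ (i : ℕ) + 1 ∧ (i : ℕ) + 1 < l
      · rw [if_pos hc, if_pos (by omega)]
        group
      · rw [if_neg hc, if_neg (by omega)]
        group

theorem omegaFun_tau_omegaFun (g : Fin m → G) : omegaFun (tauFun (omegaFun g)) = tauFun g := by
  funext i
  obtain ⟨i, hi⟩ := i
  have h0 : prolong (tauFun (omegaFun g)) 0 = (prolong g 0)⁻¹ := by
    have e : m - 1 + 1 = m := by omega
    rw [prolong_of_lt _ (by omega)]
    simp [tauFun, omegaFun, Fin.val_rev, e, prolong_of_ge]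
  have h1 : prolong (tauFun (omegaFun g)) (i + 1) = (prolong g 0)⁻¹ * prolong g (m - (i + 1)) := by
    rcases Nat.lt_or_ge (i + 1) m with hc | hc
    · have e : m - (i + 1 + 1) + 1 = m - (i + 1) := by omega
      rw [prolong_of_lt _ hc]
      simp [tauFun, omegaFun, Fin.val_rev, e]
    · have e : m - (i + 1) = 0 := by omega
      rw [prolong_of_ge _ hc, e, inv_mul_cancel]
  have h2 : prolong g (m - (i + 1)) = tauFun g ⟨i, hi⟩ := by
    rw [prolong_of_lt _ (by omega)]
    rfl
  rw [← h2]
  change (prolong (tauFun (omegaFun g)) 0)⁻¹ * prolong (tauFun (omegaFun g)) (i + 1) = _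
  rw [h0, h1]
  group

variable (G m) in
/-- The reversal `τ` as an automorphism of `𝒢_m(G)`. -/
def tau : GraphAut G m :=
  mkAut ⟨tauFun, tauFun, tauFun_tauFun, tauFun_tauFun⟩ adj_tauFun adj_tauFun

variable (G m) in
/-- The map `ω` as an automorphism of `𝒢_m(G)`; its inverse is `τ ω τ`. -/
def omega : GraphAut G m :=
  mkAut ⟨omegaFun, fun g => tauFun (omegaFun (tauFun g)),
      fun g => by
        change tauFun (omegaFun (tauFun (omegaFun g))) = g
        rw [omegaFun_tau_omegaFun, tauFun_tauFun],
      fun g => by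
        change omegaFun (tauFun (omegaFun (tauFun g))) = g
        rw [omegaFun_tau_omegaFun, tauFun_tauFun]⟩
    adj_omegaFun
    (fun _ _ H => adj_tauFun _ _ (adj_omegaFun _ _ (adj_tauFun _ _ H)))

@[simp] theorem tau_apply (g : Fin m → G) : tau G m g = tauFun g := rfl

@[simp] theorem omega_apply (g : Fin m → G) : omega G m g = omegaFun g := rfl

variable (G m) in
/-- The subgroup `𝚫_m = ⟨τ, ω⟩` of `Aut(𝒢_m(G))`. -/
def dihedralSubgroup : Subgroup (GraphAut G m) := Subgroup.closure {tau G m, omega G m}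

/-! ### Internal products of subgroups -/

/-- `K = A × B` as an internal direct product of subgroups. -/
def IsInternalDirect {Γ : Type*} [Group Γ] (A B K : Subgroup Γ) : Prop :=
  (∀ a ∈ A, ∀ b ∈ B, a * b = b * a) ∧ A ⊓ B = ⊥ ∧ A ⊔ B = K

/-- `K = N ⋊ H` as an internal semidirect product of subgroups, with `N` normal in `K`. -/
def IsInternalSemidirect {Γ : Type*} [Group Γ] (N H K : Subgroup Γ) : Prop :=
  (∀ k ∈ K, ∀ n ∈ N, k * n * k⁻¹ ∈ N) ∧ N ⊓ H = ⊥ ∧ N ⊔ H = K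

end GenericCayley

namespace GenericCayley

variable {G : Type*} [Group G] {m : ℕ}

/-! ### Difference coordinates -/

/-! In the difference coordinates `d_i = g_i⁻¹ g_{i+1}`, where `g_0 = g_{m+1} = 1`, the vertices are
the words of length `m + 1` over `G` with ordered product 1, and adjacency is Hamming distance
exactly two (`adj_iff_diff`). Here `ω` rotates a word, `τ` reverses it and inverts its letters, and
`Aut(G)` acts letterwise; all three visibly preserve the structure.

For the converse, let `F` be an automorphism fixing the identity. The neighbours of the identity are
the words of weight two, `twoPt i j x`. Two of them are adjacent only if they lie on a line (the
same two places) or on a star (the same letter at one common place, different second places). The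
graph-theoretic property `LineLike` tells lines from stars, so `F` permutes the lines. Together with
its effect on stars this makes `F` act on words of weight two by a permutation `π` of the places and
a bijection `f` of `G` (`exists_actsBy`).

A word of weight three is determined, up to one harmless exception, by its neighbours of weight two,
and its three letters multiply to 1 in the order of their places. Comparing a word with its image
shows that `f` is multiplicative or antimultiplicative according to whether `π` keeps or reverses
the cyclic order of the places (`ActsBy.mul_cases`). As `G` is non-abelian, both cannot happen.
Composing with `τ` and a power of `ω` therefore reduces to `π = 1` and `f ∈ Aut(G)`
(`ActsBy.perm_eq_one`).

An automorphism fixing the identity and all its neighbours is trivial (`eq_one_of_fix`), so `F` lies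
in `Aut(G) · Δ`. Right translations are transitive, which gives the whole group; the product
decompositions then follow from the commutation rules of the three kinds of maps. -/

/-- The sequence `1, g_1, …, g_m, 1, 1, …`. -/
def path (g : Fin m → G) : ℕ → G
  | 0 => 1
  | k + 1 => prolong g k

/-- The `m + 1` difference coordinates `g_i⁻¹ g_{i+1}` of a vertex, where `g_0 = g_{m+1} = 1`. -/
def diff (g : Fin m → G) (i : Fin (m + 1)) : G := (path g i)⁻¹ * path g (i + 1)

@[simp] theorem path_zero (g : Fin m → G) : path g 0 = 1 := rfl

theorem path_succ (g : Fin m → G) (k : ℕ) : path g (k + 1) = prolong g k := rfl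

theorem path_of_lt (g : Fin m → G) {t : ℕ} (h : m < t) : path g t = 1 := by
  obtain ⟨s, rfl⟩ := Nat.exists_eq_succ_of_ne_zero (by omega : t ≠ 0)
  exact prolong_of_ge g (by omega)

theorem path_fin_succ (g : Fin m → G) (i : Fin m) : path g (i + 1) = g i :=
  prolong_of_lt g i.isLt

theorem path_succ_eq (g : Fin m → G) (i : Fin (m + 1)) :
    path g (i + 1) = path g i * diff g i := by
  simp [diff]

theorem path_eq_left {g h : Fin m → G} {s : ℕ} (hs : s ≤ m + 1)
    (H : ∀ i : Fin (m + 1), (i : ℕ) < s → diff g i = diff h i) : path g s = path h s := by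
  induction s with
  | zero => rfl
  | succ s ih =>
    have e := H ⟨s, by omega⟩ (by simp)
    have e1 := path_succ_eq g ⟨s, by omega⟩
    have e2 := path_succ_eq h ⟨s, by omega⟩
    simp only at e1 e2
    rw [e1, e2, e, ih (by omega) fun i hi => H i (by omega)]

/-- Every path ends at 1 as well, so it can be recovered from the right end; the recursion runs
downwards from `m + 1`. -/
theorem path_eq_right {g h : Fin m → G} {s : ℕ}
    (H : ∀ i : Fin (m + 1), s ≤ (i : ℕ) → diff g i = diff h i) : path g s = path h s := by
  by_cases hs : m < s
  · rw [path_of_lt g hs, path_of_lt h hs]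
  · have ih : path g (s + 1) = path h (s + 1) := path_eq_right fun i hi => H i (by omega)
    have e := H ⟨s, by omega⟩ (by simp)
    have e1 := path_succ_eq g ⟨s, by omega⟩
    have e2 := path_succ_eq h ⟨s, by omega⟩
    simp only at e1 e2
    rw [e1, e2, e] at ih
    exact mul_right_cancel ih
  termination_by m + 1 - s

theorem ext_path {g h : Fin m → G} (H : ∀ t, t ≤ m → path g t = path h t) : g = h := by
  funext i
  rw [← path_fin_succ g, ← path_fin_succ h]
  exact H _ i.isLt

theorem diff_injective : Function.Injective (diff : (Fin m → G) → Fin (m + 1) → G) := by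
  intro g h H
  exact ext_path fun t ht => path_eq_left (by omega) fun i _ => congrFun H i

/-- The difference coordinates at all places but one determine the vertex. -/
theorem eq_of_diff_eq_off {g h : Fin m → G} (i : Fin (m + 1))
    (H : ∀ t, t ≠ i → diff g t = diff h t) : g = h := by
  apply diff_injective
  funext t
  by_cases ht : t = i
  · subst ht
    have e1 : path g t = path h t :=
      path_eq_left (by omega) fun i hi => H i (by rintro rfl; omega)
    have e2 : path g (t + 1) = path h (t + 1) :=
      path_eq_right fun i hi => H i (by rintro rfl; omega)
    rw [diff, diff, e1, e2]
  · exact H t ht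

theorem exists_of_path (p : ℕ → G) (h0 : p 0 = 1) (hm : p (m + 1) = 1) :
    ∃ g : Fin m → G, ∀ i : Fin (m + 1), diff g i = (p i)⁻¹ * p (i + 1) := by
  refine ⟨fun i => p (i + 1), fun i => ?_⟩
  have key : ∀ t, t ≤ m + 1 → path (fun i : Fin m => p (i + 1)) t = p t := by
    intro t ht
    rcases t with _ | t
    · simp [h0]
    · rw [path_succ]
      rcases Nat.lt_or_ge t m with h | h
      · rw [prolong_of_lt _ h]
      · obtain rfl : t = m := by omega
        rw [prolong_of_ge _ h, hm]
  rw [diff, key _ (by omega), key _ (by omega)]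

theorem path_block_mul {k l : ℕ} (hl : l ≤ m) (x : G) (g : Fin m → G) (t : ℕ) :
    path (block m k l x * g) t = (if k < t ∧ t ≤ l then x else 1) * path g t := by
  rcases t with _ | t
  · simp
  · rw [path_succ, path_succ, prolong_block_mul hl]
    congr 1
    simp only [Nat.lt_succ_iff, Nat.succ_le_iff]

theorem path_mul (g a : Fin m → G) (t : ℕ) : path (g * a) t = path g t * path a t := by
  rcases t with _ | t
  · simp
  · rw [path_succ, path_succ, path_succ]
    by_cases h : t < m
    · simp [prolong_of_lt _ h]
    · simp [prolong_of_ge _ (not_lt.mp h)]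

theorem diff_mul (g a : Fin m → G) (i : Fin (m + 1)) :
    diff (g * a) i = (path a i)⁻¹ * diff g i * path a (i + 1) := by
  simp only [diff, path_mul]
  group

/-- At each place a right translation acts on the letters by a bijection of `G` that does not depend
on the word. -/
theorem diff_mul_eq_iff (g h a : Fin m → G) (i : Fin (m + 1)) :
    diff (g * a) i = diff (h * a) i ↔ diff g i = diff h i := by
  simp [diff_mul]

@[simp] theorem diff_one (i : Fin (m + 1)) : diff (1 : Fin m → G) i = 1 := by
  have : ∀ t, path (1 : Fin m → G) t = 1 := by
    intro t
    rcases t with _ | t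
    · rfl
    · rw [path_succ, prolong]; split_ifs <;> rfl
  simp [diff, this]

/-- Adjacency in difference coordinates: exactly two of them change. -/
theorem adj_iff_diff {g h : Fin m → G} : (cayleyGraph G m).Adj g h ↔
    ∃ i j : Fin (m + 1), i ≠ j ∧ diff g i ≠ diff h i ∧ diff g j ≠ diff h j ∧
      ∀ t, t ≠ i → t ≠ j → diff g t = diff h t := by
  constructor
  · intro H
    obtain ⟨k, l, hkl, hl, x, hx, rfl⟩ := adj_iff.mp H
    refine ⟨⟨k, by omega⟩, ⟨l, by omega⟩, by simp; omega, ?_, ?_, ?_⟩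
    · simp only [diff, path_block_mul hl]
      rw [if_neg (by omega), if_pos (by omega)]
      simpa using hx
    · simp only [diff, path_block_mul hl]
      rw [if_pos (by omega), if_neg (by omega)]
      simpa [mul_assoc] using hx
    · rintro ⟨t, ht⟩ h1 h2
      simp only [ne_eq, Fin.mk.injEq] at h1 h2
      simp only [diff, path_block_mul hl]
      by_cases hc : k < t ∧ t ≤ l
      · rw [if_pos hc, if_pos (by omega)]; group
      · rw [if_neg hc, if_neg (by omega)]; group
  · rintro ⟨i, j, hij, hi, hj, H⟩
    wlog hlt : i < j generalizing i j with W
    · exact W j i hij.symm hj hi (fun t h1 h2 => H t h2 h1) (lt_of_le_of_ne (not_lt.mp hlt) hij.symm)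
    have hlt' : (i : ℕ) < j := hlt
    -- The paths agree up to place `i` and after place `j`. In between their increments agree, so
    -- they differ by the constant left factor `c`.
    set c := path h (i + 1) * (path g (i + 1))⁻¹ with hc
    have eL : ∀ t, t ≤ (i : ℕ) → path g t = path h t := fun t ht =>
      path_eq_left (by omega) fun a ha => H a (by rintro rfl; omega) (by rintro rfl; omega)
    have eR : ∀ t, (j : ℕ) < t → path g t = path h t := fun t ht =>
      path_eq_right fun a ha => H a (by rintro rfl; omega) (by rintro rfl; omega)
    have eM : ∀ d, (i : ℕ) + 1 + d ≤ j → path h (i + 1 + d) = c * path g (i + 1 + d) := by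
      intro d
      induction d with
      | zero => intro _; simp [hc]
      | succ d ih =>
        intro hd
        have e := H ⟨i + 1 + d, by omega⟩ (by intro h; simp [Fin.ext_iff] at h; omega)
          (by intro h; simp [Fin.ext_iff] at h; omega)
        have e1 := path_succ_eq g ⟨i + 1 + d, by omega⟩
        have e2 := path_succ_eq h ⟨i + 1 + d, by omega⟩
        simp only at e1 e2
        rw [← add_assoc, e1, e2, ih (by omega), e, mul_assoc]
    refine adj_iff.mpr ⟨i, j, hlt', by omega, c, ?_, ?_⟩
    · intro h1
      apply hi
      have : path h (i + 1) = path g (i + 1) := by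
        rw [hc] at h1; exact mul_inv_eq_one.mp h1
      rw [diff, diff, this, eL i le_rfl]
    · refine ext_path fun t ht => ?_
      rw [path_block_mul (by omega)]
      by_cases h1 : t ≤ i
      · rw [if_neg (by omega), one_mul, eL t h1]
      · by_cases h2 : t ≤ j
        · rw [if_pos (by omega)]
          have := eM (t - (i + 1)) (by omega)
          rwa [show (i : ℕ) + 1 + (t - (i + 1)) = t by omega] at this
        · rw [if_neg (by omega), one_mul, eR t (by omega)]

/-! ### Words of weight two -/

/-- The vertex with difference coordinates `x` at `i`, `x⁻¹` at `j` and `1` elsewhere. -/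
def twoPt (i j : Fin (m + 1)) (x : G) : Fin m → G :=
  if i < j then block m i j x else block m j i x⁻¹

theorem diff_block (i j t : Fin (m + 1)) (hij : i < j) (x : G) :
    diff (block m i j x) t = if t = i then x else if t = j then x⁻¹ else 1 := by
  have hij' : (i : ℕ) < j := hij
  have h1 : ∀ s, path (block m i j x) s = if (i : ℕ) < s ∧ s ≤ j then x else 1 := by
    intro s
    have := path_block_mul (k := i) (show (j : ℕ) ≤ m by omega) x 1 s
    rw [mul_one] at this
    rw [this]
    have h2 : path (1 : Fin m → G) s = 1 := by
      rcases s with _ | s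
      · rfl
      · rw [path_succ, prolong]; split_ifs <;> rfl
    rw [h2, mul_one]
  rw [diff, h1, h1]
  simp only [Fin.ext_iff]
  split_ifs <;> first | omega | simp

theorem diff_twoPt {i j : Fin (m + 1)} (hij : i ≠ j) (x : G) (t : Fin (m + 1)) :
    diff (twoPt i j x) t = if t = i then x else if t = j then x⁻¹ else 1 := by
  unfold twoPt
  split_ifs with h h1 h2 h2 h1
  all_goals first
    | rw [diff_block _ _ _ h]
    | rw [diff_block _ _ _ (lt_of_le_of_ne (not_lt.mp h) hij.symm)]
  all_goals grind [inv_inv]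

/-- The letter at `j` is forced, because the letters at all other places determine the word. -/
theorem eq_twoPt {i j : Fin (m + 1)} (hij : i ≠ j) {g : Fin m → G}
    (H : ∀ t, t ≠ i → t ≠ j → diff g t = 1) : g = twoPt i j (diff g i) := by
  apply eq_of_diff_eq_off j
  intro t ht
  rw [diff_twoPt hij]
  split_ifs with h
  · rw [h]
  · exact H t h ht

theorem twoPt_swap {i j : Fin (m + 1)} (hij : i ≠ j) (x : G) :
    twoPt i j x = twoPt j i x⁻¹ := by
  apply diff_injective
  funext t
  rw [diff_twoPt hij, diff_twoPt hij.symm]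
  grind [inv_inv]

theorem twoPt_one (i j : Fin (m + 1)) : twoPt i j (1 : G) = (1 : Fin m → G) := by
  unfold twoPt
  split_ifs <;> simp [block_one]

theorem twoPt_mul (i j : Fin (m + 1)) (x y : G) (h : i < j) :
    twoPt i j x * twoPt i j y = (twoPt i j (x * y) : Fin m → G) := by
  simp [twoPt, h, block_mul]

theorem adj_one_iff {p : Fin m → G} : (cayleyGraph G m).Adj 1 p ↔
    ∃ i j : Fin (m + 1), ∃ x : G, i ≠ j ∧ x ≠ 1 ∧ p = twoPt i j x := by
  rw [adj_iff_diff]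
  constructor
  · rintro ⟨i, j, hij, hi, hj, H⟩
    refine ⟨i, j, diff p i, hij, by simpa using hi.symm, eq_twoPt hij fun t h1 h2 => ?_⟩
    rw [← H t h1 h2, diff_one]
  · rintro ⟨i, j, x, hij, hx, rfl⟩
    refine ⟨i, j, hij, ?_, ?_, ?_⟩
    · rw [diff_twoPt hij]; simpa using hx.symm
    · rw [diff_twoPt hij]; simpa [hij.symm] using hx
    · intro t h1 h2
      rw [diff_twoPt hij]; simp [h1, h2]

/-- If all difference coordinates are trivial but those at `i < j < k`, then these multiply to `1`. -/
theorem diff_mul_diff_mul_diff {g : Fin m → G} {i j k : Fin (m + 1)} (hij : i < j) (hjk : j < k)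
    (H : ∀ t, t ≠ i → t ≠ j → t ≠ k → diff g t = 1) : diff g i * diff g j * diff g k = 1 := by
  have key : ∀ s d, s + d ≤ m + 1 → (∀ t : Fin (m + 1), s ≤ (t : ℕ) → (t : ℕ) < s + d →
      diff g t = 1) → path g (s + d) = path g s := by
    intro s d
    induction d with
    | zero => simp
    | succ d ih =>
      intro h1 h2
      have e := path_succ_eq g ⟨s + d, by omega⟩
      simp only at e
      rw [← add_assoc, e, h2 ⟨s + d, by omega⟩ (by simp) (by simp), mul_one]
      exact ih (by omega) fun t h3 h4 => h2 t h3 (by omega)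
  have key' : ∀ a b, a ≤ b → b ≤ m + 1 → (∀ t : Fin (m + 1), a ≤ (t : ℕ) → (t : ℕ) < b →
      diff g t = 1) → path g b = path g a := by
    intro a b hab hb h
    have := key a (b - a) (by omega) (by simpa [Nat.add_sub_cancel' hab] using h)
    rwa [Nat.add_sub_cancel' hab] at this
  have hij' : (i : ℕ) < j := hij
  have hjk' : (j : ℕ) < k := hjk
  have hne : ∀ t : Fin (m + 1), (t : ℕ) ≠ i → (t : ℕ) ≠ j → (t : ℕ) ≠ k → diff g t = 1 :=
    fun t h1 h2 h3 => H t (by simpa [Fin.ext_iff] using h1) (by simpa [Fin.ext_iff] using h2)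
      (by simpa [Fin.ext_iff] using h3)
  have e1 := key' 0 i (by omega) (by omega) fun t _ _ => hne t (by omega) (by omega) (by omega)
  have e2 := key' (i + 1) j (by omega) (by omega) fun t _ _ =>
    hne t (by omega) (by omega) (by omega)
  have e3 := key' (j + 1) k (by omega) (by omega) fun t _ _ =>
    hne t (by omega) (by omega) (by omega)
  have e4 := key' (k + 1) (m + 1) (by omega) le_rfl fun t _ _ =>
    hne t (by omega) (by omega) (by omega)
  rw [path_of_lt g (by omega), path_succ_eq, e3, path_succ_eq, e2, path_succ_eq, e1] at e4
  simpa using e4.symm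

/-- Words of weight three. -/
theorem exists_three {i j k : Fin (m + 1)} (hij : i < j) (hjk : j < k) (a b : G) :
    ∃ g : Fin m → G, diff g i = a ∧ diff g j = b ∧ diff g k = (a * b)⁻¹ ∧
      ∀ t, t ≠ i → t ≠ j → t ≠ k → diff g t = 1 := by
  have hij' : (i : ℕ) < j := hij
  have hjk' : (j : ℕ) < k := hjk
  obtain ⟨g, hg⟩ := exists_of_path (m := m)
    (fun t => if t ≤ i then 1 else if t ≤ j then a else if t ≤ k then a * b else 1)
    (by simp) (by rw [if_neg (by omega), if_neg (by omega), if_neg (by omega)])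
  refine ⟨g, ?_, ?_, ?_, fun t h1 h2 h3 => ?_⟩
  on_goal 4 => simp only [ne_eq, Fin.ext_iff] at h1 h2 h3
  all_goals
    rw [hg]
    split_ifs <;> first | omega | simp

/-- Words whose coordinates are powers of one element. -/
theorem exists_zpow (x : G) (s : Fin (m + 1) → ℤ) (hs : ∑ i, s i = 0) :
    ∃ g : Fin m → G, ∀ i, diff g i = x ^ s i := by
  -- The exponents along the path are the partial sums of `s`; the path closes up at 1 because the
  -- total is zero.
  obtain ⟨g, hg⟩ := exists_of_path (m := m)
    (fun t => x ^ (∑ i ∈ Finset.range t, if h : i < m + 1 then s ⟨i, h⟩ else 0))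
    (by simp) (by
      have : (∑ i ∈ Finset.range (m + 1), if h : i < m + 1 then s ⟨i, h⟩ else 0) = 0 := by
        rw [Finset.sum_range, ← hs]
        exact Finset.sum_congr rfl fun i _ => dif_pos i.isLt
      simp only [this, zpow_zero])
  refine ⟨g, fun i => ?_⟩
  rw [hg, Finset.sum_range_succ, zpow_add, dif_pos i.isLt]
  simp

/-! ### Adjacency among the neighbours of the identity -/

/-- Two words never differ at exactly one place, so distinct words that agree off two places differ
at both. -/
theorem adj_of_diff_eq {g h : Fin m → G} {i j : Fin (m + 1)} (hgh : g ≠ h) (hij : i ≠ j)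
    (H : ∀ t, t ≠ i → t ≠ j → diff g t = diff h t) : (cayleyGraph G m).Adj g h := by
  refine adj_iff_diff.mpr ⟨i, j, hij, fun h1 => hgh ?_, fun h1 => hgh ?_, H⟩
  · refine eq_of_diff_eq_off j fun t ht => ?_
    by_cases hti : t = i
    · rwa [hti]
    · exact H t hti ht
  · refine eq_of_diff_eq_off i fun t ht => ?_
    by_cases htj : t = j
    · rwa [htj]
    · exact H t ht htj

theorem diff_eq_of_adj {g h : Fin m → G} (H : (cayleyGraph G m).Adj g h) {i j k : Fin (m + 1)}
    (hij : i ≠ j) (hik : i ≠ k) (hjk : j ≠ k) :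
    diff g i = diff h i ∨ diff g j = diff h j ∨ diff g k = diff h k := by
  obtain ⟨a, b, hab, h1, h2, h3⟩ := adj_iff_diff.mp H
  grind

theorem twoPt_ne_one {i j : Fin (m + 1)} (hij : i ≠ j) {x : G} (hx : x ≠ 1) :
    twoPt i j x ≠ (1 : Fin m → G) := by
  intro h
  have := congrFun (congrArg diff h) i
  rw [diff_twoPt hij, diff_one, if_pos rfl] at this
  exact hx this

theorem twoPt_inj {i j : Fin (m + 1)} (hij : i ≠ j) {x y : G} :
    (twoPt i j x : Fin m → G) = twoPt i j y ↔ x = y := by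
  refine ⟨fun h => ?_, fun h => h ▸ rfl⟩
  have := congrFun (congrArg diff h) i
  rwa [diff_twoPt hij, diff_twoPt hij, if_pos rfl, if_pos rfl] at this

theorem adj_one_twoPt {i j : Fin (m + 1)} (hij : i ≠ j) {x : G} (hx : x ≠ 1) :
    (cayleyGraph G m).Adj 1 (twoPt i j x) :=
  adj_one_iff.mpr ⟨i, j, x, hij, hx, rfl⟩

theorem adj_twoPt_line {i j : Fin (m + 1)} (hij : i ≠ j) {x y : G} (hxy : x ≠ y) :
    (cayleyGraph G m).Adj (twoPt i j x) (twoPt i j y) :=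
  adj_of_diff_eq (fun h => hxy ((twoPt_inj hij).mp h)) hij fun t h1 h2 => by
    simp [diff_twoPt hij, h1, h2]

theorem adj_twoPt_star {i j k : Fin (m + 1)} (hij : i ≠ j) (hik : i ≠ k) (hjk : j ≠ k) {x : G}
    (hx : x ≠ 1) : (cayleyGraph G m).Adj (twoPt i j x) (twoPt i k x) := by
  refine adj_of_diff_eq (i := j) (j := k) (fun h => ?_) hjk fun t h1 h2 => ?_
  · have := congrFun (congrArg diff h) j
    rw [diff_twoPt hij, diff_twoPt hik] at this
    simp [hij.symm, hjk, hx] at this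
  · simp [diff_twoPt hij, diff_twoPt hik, h1, h2]

theorem eq_of_adj_twoPt {i j k : Fin (m + 1)} (hij : i ≠ j) (hik : i ≠ k) (hjk : j ≠ k) {x y : G}
    (hx : x ≠ 1) (hy : y ≠ 1) (H : (cayleyGraph G m).Adj (twoPt i j x) (twoPt i k y)) :
    x = y := by
  have := diff_eq_of_adj H hij hik hjk
  simp only [diff_twoPt hij, diff_twoPt hik] at this
  grind [inv_eq_one]

theorem not_adj_twoPt_of_disjoint {i j k l : Fin (m + 1)} (hij : i ≠ j) (hkl : k ≠ l) (hik : i ≠ k)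
    (hil : i ≠ l) (hjk : j ≠ k) (hjl : j ≠ l) {x y : G} (hx : x ≠ 1) (hy : y ≠ 1) :
    ¬ (cayleyGraph G m).Adj (twoPt i j x) (twoPt k l y) := by
  intro H
  have := diff_eq_of_adj H hij hik hjk
  simp only [diff_twoPt hij, diff_twoPt hkl] at this
  grind [inv_eq_one]

/-- Two adjacent neighbours of the identity lie on a line or on a star. -/
theorem adj_twoPt_cases {i j : Fin (m + 1)} {x : G} (hij : i ≠ j) (hx : x ≠ 1) {q : Fin m → G}
    (hq : (cayleyGraph G m).Adj 1 q) (H : (cayleyGraph G m).Adj (twoPt i j x) q) :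
    (∃ y, y ≠ 1 ∧ y ≠ x ∧ q = twoPt i j y) ∨
    (∃ k, k ≠ i ∧ k ≠ j ∧ q = twoPt i k x) ∨ (∃ k, k ≠ i ∧ k ≠ j ∧ q = twoPt j k x⁻¹) := by
  obtain ⟨k, l, y, hkl, hy, rfl⟩ := adj_one_iff.mp hq
  have star : ∀ l y, l ≠ i → l ≠ j → y ≠ 1 →
      (cayleyGraph G m).Adj (twoPt i j x) (twoPt i l y) → x = y := fun l y h1 h2 h3 h4 =>
    eq_of_adj_twoPt hij h1.symm h2.symm hx h3 h4
  have star' : ∀ l y, l ≠ i → l ≠ j → y ≠ 1 →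
      (cayleyGraph G m).Adj (twoPt i j x) (twoPt j l y) → x⁻¹ = y := fun l y h1 h2 h3 h4 => by
    rw [twoPt_swap hij] at h4
    exact eq_of_adj_twoPt hij.symm h2.symm h1.symm (by simpa using hx) h3 h4
  have line : ∀ y, (cayleyGraph G m).Adj (twoPt i j x) (twoPt i j y) → y ≠ x := by
    rintro y h rfl
    exact h.ne rfl
  have hy' : y⁻¹ ≠ 1 := by simpa using hy
  by_cases hki : k = i
  · subst hki
    by_cases hlj : l = j
    · subst hlj
      exact Or.inl ⟨y, hy, line y H, rfl⟩
    · exact Or.inr (Or.inl ⟨l, hkl.symm, hlj, by rw [star l y hkl.symm hlj hy H]⟩)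
  by_cases hkj : k = j
  · subst hkj
    by_cases hli : l = i
    · subst hli
      rw [twoPt_swap hkl] at H ⊢
      exact Or.inl ⟨y⁻¹, hy', line _ H, rfl⟩
    · exact Or.inr (Or.inr ⟨l, hli, hkl.symm, by rw [star' l y hli hkl.symm hy H]⟩)
  by_cases hli : l = i
  · subst hli
    rw [twoPt_swap hkl] at H ⊢
    exact Or.inr (Or.inl ⟨k, hkl, hkj, by rw [star k _ hkl hkj hy' H]⟩)
  by_cases hlj : l = j
  · subst hlj
    rw [twoPt_swap hkl] at H ⊢
    exact Or.inr (Or.inr ⟨k, hki, hkl, by rw [star' k _ hki hkl hy' H]⟩)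
  exact absurd H (not_adj_twoPt_of_disjoint hij hkl (Ne.symm hki) (Ne.symm hli) (Ne.symm hkj)
    (Ne.symm hlj) hx hy)

/-- Common neighbours of the identity and two points of a star. -/
theorem common_adj_star {i j k : Fin (m + 1)} {x : G} (hij : i ≠ j) (hik : i ≠ k) (hjk : j ≠ k)
    (hx : x ≠ 1) {u : Fin m → G} (hu : (cayleyGraph G m).Adj 1 u)
    (hj : (cayleyGraph G m).Adj (twoPt i j x) u) (hk : (cayleyGraph G m).Adj (twoPt i k x) u) :
    (∃ l, l ≠ i ∧ l ≠ j ∧ l ≠ k ∧ u = twoPt i l x) ∨ (x⁻¹ = x ∧ u = twoPt j k x⁻¹) := by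
  rcases adj_twoPt_cases hij hx hu hj with ⟨y, hy, hyx, rfl⟩ | ⟨l, hli, hlj, rfl⟩ | ⟨l, hli, hlj, rfl⟩
  · exact absurd (eq_of_adj_twoPt hik hij hjk.symm hx hy hk) hyx.symm
  · rcases eq_or_ne l k with rfl | hlk
    · exact absurd rfl hk.ne
    · exact Or.inl ⟨l, hli, hlj, hlk, rfl⟩
  · have hx' : x⁻¹ ≠ 1 := by simpa using hx
    rcases eq_or_ne l k with rfl | hlk
    -- The third side of the triangle `i`, `j`, `k` meets both given points only if `x` is an
    -- involution.
    · refine Or.inr ⟨?_, rfl⟩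
      rw [twoPt_swap hik, twoPt_swap hjk, inv_inv] at hk
      exact eq_of_adj_twoPt hik.symm hjk.symm hij hx' hx hk
    · exact absurd hk (not_adj_twoPt_of_disjoint hik hlj.symm hij hli.symm hjk.symm hlk.symm hx hx')

/-! ### Recognising lines -/

/-- A graph-theoretic property which, for `m ≥ 3`, holds for the pairs `p`, `q` of neighbours of the
identity that are adjacent but not on one line. -/
def IsStarPair (p q : Fin m → G) : Prop :=
  ∃ v, (cayleyGraph G m).Adj v p ∧ (cayleyGraph G m).Adj v q ∧ v ≠ 1 ∧
    ¬ (cayleyGraph G m).Adj 1 v ∧ ∀ u, (cayleyGraph G m).Adj 1 u → (cayleyGraph G m).Adj v u →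
      u = p ∨ u = q ∨ (cayleyGraph G m).Adj u p ∨ (cayleyGraph G m).Adj u q

/-- A graph-theoretic property that implies collinearity of two neighbours of the identity. -/
def LineLike (p q : Fin m → G) : Prop :=
  (cayleyGraph G m).Adj p q ∧ ¬ IsStarPair p q ∧
    ∃ u v, u ≠ v ∧ (cayleyGraph G m).Adj 1 u ∧ (cayleyGraph G m).Adj p u ∧
      (cayleyGraph G m).Adj q u ∧ (cayleyGraph G m).Adj 1 v ∧ (cayleyGraph G m).Adj p v ∧
      (cayleyGraph G m).Adj q v

/-- The witness `v` has letter `x` at `i` and at the spare place `f`, and `x⁻¹` at `j` and `k`. A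
word of weight two within distance two of this word of weight four must be a part of it: one of the
two given points, one of the pairs `f, j` and `f, k`, or, for an involution `x`, also `i, f` or `j,
k`. Each of the latter shares a letter with a given point. -/
theorem isStarPair_twoPt {i j k f : Fin (m + 1)} {x : G} (hij : i ≠ j) (hik : i ≠ k) (hjk : j ≠ k)
    (hfi : f ≠ i) (hfj : f ≠ j) (hfk : f ≠ k) (hx : x ≠ 1) :
    IsStarPair (twoPt i j x : Fin m → G) (twoPt i k x) := by
  have hx' : x⁻¹ ≠ 1 := by simpa using hx
  obtain ⟨v, hv⟩ := exists_zpow (m := m) x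
    (Pi.single i 1 + Pi.single f 1 - Pi.single j 1 - Pi.single k 1) (by
      simp [Finset.sum_add_distrib, Finset.sum_sub_distrib])
  have vi : diff v i = x := by simp [hv, hij, hik, hfi.symm]
  have vf : diff v f = x := by simp [hv, hfi, hfj, hfk]
  have vj : diff v j = x⁻¹ := by simp [hv, hij.symm, hfj.symm, hjk]
  have vk : diff v k = x⁻¹ := by simp [hv, hik.symm, hfk.symm, hjk.symm]
  have vt : ∀ t, t ≠ i → t ≠ f → t ≠ j → t ≠ k → diff v t = 1 := by
    intro t h1 h2 h3 h4
    simp [hv, h1, h2, h3, h4]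
  refine ⟨v, ?_, ?_, ?_, ?_, ?_⟩
  · refine adj_of_diff_eq (i := f) (j := k) (fun h => ?_) hfk fun t h1 h2 => ?_
    · have e := diff_twoPt hij x f
      rw [← h, vf] at e
      simp [hfi, hfj, hx] at e
    · rw [diff_twoPt hij]
      grind
  · refine adj_of_diff_eq (i := f) (j := j) (fun h => ?_) hfj fun t h1 h2 => ?_
    · have e := diff_twoPt hik x f
      rw [← h, vf] at e
      simp [hfi, hfk, hx] at e
    · rw [diff_twoPt hik]
      grind
  · rintro rfl
    rw [diff_one] at vi
    exact hx vi.symm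
  · intro H
    have := diff_eq_of_adj H hij hik hjk
    simp only [diff_one] at this
    grind
  · intro u hu hvu
    obtain ⟨a, b, y, hab, hy, rfl⟩ := adj_one_iff.mp hu
    have hy' : y⁻¹ ≠ 1 := by simpa using hy
    have e1 := diff_eq_of_adj hvu hij hik hjk
    have e2 := diff_eq_of_adj hvu hij hfi.symm hfj.symm
    have e3 := diff_eq_of_adj hvu hik hfi.symm hfk.symm
    have e4 := diff_eq_of_adj hvu hjk hfj.symm hfk.symm
    simp only [diff_twoPt hab, vi, vj, vk, vf] at e1 e2 e3 e4
    have star : ∀ {α β γ : Fin (m + 1)} {z : G}, α ≠ β → α ≠ γ → β ≠ γ → z ≠ 1 →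
      (cayleyGraph G m).Adj (twoPt α β z) (twoPt α γ z) := fun h1 h2 h3 h4 =>
        adj_twoPt_star h1 h2 h3 h4
    have u' := twoPt_swap (G := G) hab y
    have p' := twoPt_swap (G := G) hij x
    have q' := twoPt_swap (G := G) hik x
    have ha : a = i ∨ a = j ∨ a = k ∨ a = f := by grind
    have hb : b = i ∨ b = j ∨ b = k ∨ b = f := by grind
    have ea : y = if a = i ∨ a = f then x else x⁻¹ := by grind
    have eb : y⁻¹ = if b = i ∨ b = f then x else x⁻¹ := by grind
    clear e1 e2 e3 e4 vt vi vj vk vf hvu hu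
    rcases ha with rfl | rfl | rfl | rfl <;> rcases hb with rfl | rfl | rfl | rfl <;> grind

/-- The point `u` agrees with `v` at `k` and has its second place at `i` or `j`. The place `j` works
unless the letter of `v` at `k` is `x`; in that case `i` works, thanks to `y ≠ x⁻¹`. -/
theorem exists_far_point {i j k : Fin (m + 1)} {x y : G} {v : Fin m → G} (hij : i ≠ j)
    (hki : k ≠ i) (hkj : k ≠ j) (hx : x ≠ 1) (hy : y ≠ 1) (hyx : y ≠ x⁻¹)
    (vi : diff v i = x) (vj : diff v j = y⁻¹) (vk : diff v k ≠ 1)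
    (vt : ∀ t, t ≠ i → t ≠ j → t ≠ k → diff v t = 1) :
    ∃ u, (cayleyGraph G m).Adj 1 u ∧ (cayleyGraph G m).Adj v u ∧ u ≠ twoPt i j x ∧
      u ≠ twoPt i j y ∧ ¬ (cayleyGraph G m).Adj u (twoPt i j x) ∧
      ¬ (cayleyGraph G m).Adj u (twoPt i j y) := by
  have hx' : x⁻¹ ≠ 1 := by simpa using hx
  have hy' : y⁻¹ ≠ 1 := by simpa using hy
  have vk' : (diff v k)⁻¹ ≠ 1 := by simpa using vk
  have ne : ∀ {a : Fin (m + 1)} {z w : G}, a ≠ k → w ≠ 1 → twoPt a k w ≠ twoPt i j z := by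
    intro a z w ha hw h
    have := congrFun (congrArg diff h) k
    rw [diff_twoPt ha, diff_twoPt hij] at this
    simp [ha.symm, hki, hkj, hw] at this
  by_cases hc : diff v k = x
  · refine ⟨twoPt i k x⁻¹, adj_one_twoPt hki.symm hx', ?_, ne hki.symm hx', ne hki.symm hx', ?_, ?_⟩
    · refine adj_of_diff_eq (i := i) (j := j) (fun h => ?_) hij fun t h1 h2 => ?_
      · have := congrFun (congrArg diff h) j
        rw [diff_twoPt hki.symm, vj] at this
        simp [hij.symm, hkj.symm, hy] at this
      · rw [diff_twoPt hki.symm]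
        grind [inv_inv]
    · intro H
      have e := eq_of_adj_twoPt hki.symm hij hkj hx' hx H
      have : v = twoPt i k x := by
        refine eq_of_diff_eq_off j fun t ht => ?_
        rw [diff_twoPt hki.symm]
        grind
      have e2 := diff_twoPt hki.symm x j
      rw [← this, vj] at e2
      simp [hij.symm, hkj.symm, hy] at e2
    · intro H
      exact hyx (eq_of_adj_twoPt hki.symm hij hkj hx' hy H).symm
  · refine ⟨twoPt j k (diff v k)⁻¹, adj_one_twoPt hkj.symm vk', ?_, ne hkj.symm vk',
      ne hkj.symm vk', ?_, ?_⟩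
    · refine adj_of_diff_eq (i := i) (j := j) (fun h => ?_) hij fun t h1 h2 => ?_
      · have := congrFun (congrArg diff h) i
        rw [diff_twoPt hkj.symm, vi] at this
        simp [hij, hki.symm, hx] at this
      · rw [diff_twoPt hkj.symm]
        grind [inv_inv]
    · intro H
      rw [twoPt_swap hij] at H
      exact hc (inv_injective (eq_of_adj_twoPt hkj.symm hij.symm hki vk' hx' H))
    · intro H
      rw [twoPt_swap hij] at H
      have e := inv_injective (eq_of_adj_twoPt hkj.symm hij.symm hki vk' hy' H)
      have : v = twoPt j k y⁻¹ := by
        refine eq_of_diff_eq_off i fun t ht => ?_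
        rw [diff_twoPt hkj.symm]
        grind [inv_inv]
      have e2 := diff_twoPt hkj.symm y⁻¹ i
      rw [← this, vi] at e2
      simp [hij, hki.symm, hx] at e2

/-- A candidate `v` has a nontrivial letter at some `k` off the line. Being adjacent to both points,
it must share one letter with each of them, one at `i` and the other at `j`, so it has weight three
and `exists_far_point` refutes it. -/
theorem not_isStarPair_line {i j : Fin (m + 1)} {x y : G} (hij : i ≠ j) (hx : x ≠ 1) (hy : y ≠ 1)
    (hxy : x ≠ y) (hyx : y ≠ x⁻¹) : ¬ IsStarPair (twoPt i j x : Fin m → G) (twoPt i j y) := by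
  rintro ⟨v, hp, hq, hv, hv', H⟩
  obtain ⟨k, hki, hkj, vk⟩ : ∃ k, k ≠ i ∧ k ≠ j ∧ diff v k ≠ 1 := by
    by_contra! h
    have e := eq_twoPt hij h
    by_cases h1 : diff v i = 1
    · rw [h1, twoPt_one] at e
      exact hv e
    · exact hv' (e ▸ adj_one_twoPt hij h1)
  have ep := fun t (h1 : t ≠ i) (h2 : t ≠ j) => diff_eq_of_adj hp hij h1.symm h2.symm
  have eq := fun t (h1 : t ≠ i) (h2 : t ≠ j) => diff_eq_of_adj hq hij h1.symm h2.symm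
  have ep' := fun a t (ha : a ≠ k) (h1 : t ≠ a) (h2 : t ≠ k) =>
    diff_eq_of_adj hp ha h1.symm h2.symm
  simp only [diff_twoPt hij] at ep eq ep'
  have vp : diff v i = x ∨ diff v j = x⁻¹ := by grind
  have vq : diff v i = y ∨ diff v j = y⁻¹ := by grind
  have hxy' : x⁻¹ ≠ y⁻¹ := fun h => hxy (inv_injective h)
  have hc : (diff v i = x ∧ diff v j = y⁻¹) ∨ (diff v i = y ∧ diff v j = x⁻¹) := by grind
  have vt : ∀ t, t ≠ i → t ≠ j → t ≠ k → diff v t = 1 := by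
    intro t h1 h2 h3
    have e1 := ep' i t hki.symm h1 h3
    have e2 := ep' j t hkj.symm h2 h3
    grind
  rcases hc with ⟨vi, vj⟩ | ⟨vi, vj⟩
  · obtain ⟨u, h1, h2, h3, h4, h5, h6⟩ := exists_far_point hij hki hkj hx hy hyx vi vj vk vt
    rcases H u h1 h2 with h | h | h | h <;> contradiction
  · have hyx' : x ≠ y⁻¹ := fun h => hyx (by rw [h, inv_inv])
    obtain ⟨u, h1, h2, h3, h4, h5, h6⟩ := exists_far_point hij hki hkj hy hx hyx' vi vj vk vt
    rcases H u h1 h2 with h | h | h | h <;> contradiction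

/-- A non-abelian group has at least five elements. -/
theorem exists_two_avoiding (hG : ¬ ∀ a b : G, a * b = b * a) (x y : G) :
    ∃ u v : G, u ≠ v ∧ u ≠ 1 ∧ v ≠ 1 ∧ u ≠ x ∧ v ≠ x ∧ u ≠ y ∧ v ≠ y := by
  classical
  push Not at hG
  obtain ⟨a, b, hab⟩ := hG
  have h5 : ({1, a, b, a * b, b * a} : Finset G).card = 5 := by
    have h1 : a ≠ 1 := by rintro rfl; simp at hab
    have h2 : b ≠ 1 := by rintro rfl; simp at hab
    have h3 : a ≠ b := by rintro rfl; simp at hab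
    have h4 : a * b ≠ 1 := fun h => hab (h.trans (mul_eq_one_comm.mp h).symm)
    have h5 : b * a ≠ 1 := fun h => h4 (mul_eq_one_comm.mp h)
    have h6 : a ≠ a * b := by simpa using h2
    have h7 : a ≠ b * a := by simpa using h2
    have h8 : b ≠ a * b := by simpa using h1
    have h9 : b ≠ b * a := by simpa using h1
    repeat rw [Finset.card_insert_of_notMem (by simp [*, Ne.symm])]
    simp
  have h3 : ({1, x, y} : Finset G).card ≤ 3 := Finset.card_le_three
  have h2 : 1 < (({1, a, b, a * b, b * a} : Finset G) \ {1, x, y}).card := by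
    have := Finset.le_card_sdiff ({1, x, y} : Finset G) {1, a, b, a * b, b * a}
    omega
  obtain ⟨u, hu, v, hv, huv⟩ := Finset.one_lt_card.mp h2
  simp only [Finset.mem_sdiff, Finset.mem_insert, Finset.mem_singleton, not_or] at hu hv
  exact ⟨u, v, huv, hu.2.1, hv.2.1, hu.2.2.1, hv.2.2.1, hu.2.2.2, hv.2.2.2⟩

theorem exists_mul_self_ne_one (hG : ¬ ∀ a b : G, a * b = b * a) : ∃ x : G, x⁻¹ ≠ x := by
  by_contra! h
  refine hG fun a b => ?_
  rw [← h (a * b), mul_inv_rev, h, h]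

theorem lineLike_twoPt (hG : ¬ ∀ a b : G, a * b = b * a) {i j : Fin (m + 1)} {x y : G}
    (hij : i ≠ j) (hx : x ≠ 1) (hy : y ≠ 1) (hxy : x ≠ y) (hyx : y ≠ x⁻¹) :
    LineLike (twoPt i j x : Fin m → G) (twoPt i j y) := by
  obtain ⟨u, v, huv, hu, hv, hux, hvx, huy, hvy⟩ := exists_two_avoiding hG x y
  exact ⟨adj_twoPt_line hij hxy, not_isStarPair_line hij hx hy hxy hyx, twoPt i j u, twoPt i j v,
    fun h => huv ((twoPt_inj hij).mp h), adj_one_twoPt hij hu, adj_twoPt_line hij hux.symm,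
    adj_twoPt_line hij huy.symm, adj_one_twoPt hij hv, adj_twoPt_line hij hvx.symm,
    adj_twoPt_line hij hvy.symm⟩

/-- A fourth place makes the pair a star pair. With three places only, the pair and the identity
have at most one common neighbour, the third side of the triangle, whereas `LineLike` asks for two.
-/
theorem not_lineLike_star {i j k : Fin (m + 1)} {x : G} (hij : i ≠ j) (hik : i ≠ k) (hjk : j ≠ k)
    (hx : x ≠ 1) : ¬ LineLike (twoPt i j x : Fin m → G) (twoPt i k x) := by
  rintro ⟨-, h1, u, v, huv, hu, hpu, hqu, hv, hpv, hqv⟩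
  by_cases hf : ∃ f, f ≠ i ∧ f ≠ j ∧ f ≠ k
  · obtain ⟨f, hfi, hfj, hfk⟩ := hf
    exact h1 (isStarPair_twoPt hij hik hjk hfi hfj hfk hx)
  · rcases common_adj_star hij hik hjk hx hu hpu hqu with ⟨l, h⟩ | ⟨-, hu'⟩
    · exact hf ⟨l, h.1, h.2.1, h.2.2.1⟩
    rcases common_adj_star hij hik hjk hx hv hpv hqv with ⟨l, h⟩ | ⟨-, hv'⟩
    · exact hf ⟨l, h.1, h.2.1, h.2.2.1⟩
    exact huv (hu'.trans hv'.symm)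

theorem exists_eq_of_lineLike {i j : Fin (m + 1)} {x : G} (hij : i ≠ j) (hx : x ≠ 1)
    {q : Fin m → G} (hq : (cayleyGraph G m).Adj 1 q) (H : LineLike (twoPt i j x) q) :
    ∃ y, y ≠ 1 ∧ q = twoPt i j y := by
  rcases adj_twoPt_cases hij hx hq H.1 with ⟨y, hy, -, h⟩ | ⟨k, hki, hkj, rfl⟩ | ⟨k, hki, hkj, rfl⟩
  · exact ⟨y, hy, h⟩
  · exact absurd H (not_lineLike_star hij hki.symm hkj.symm hx)
  · rw [twoPt_swap hij] at H
    exact absurd H (not_lineLike_star hij.symm hkj.symm hki.symm (by simpa using hx))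

/-! ### Automorphisms that fix the identity map lines to lines -/

theorem map_adj_iff (F : GraphAut G m) {p q : Fin m → G} :
    (cayleyGraph G m).Adj (F p) (F q) ↔ (cayleyGraph G m).Adj p q := F.map_rel_iff

theorem inv_fix {F : GraphAut G m} (h1 : F 1 = 1) : F⁻¹ 1 = 1 := by
  conv_lhs => rw [← h1]
  exact F.symm_apply_apply 1

theorem map_adj_one_iff {F : GraphAut G m} (h1 : F 1 = 1) {q : Fin m → G} :
    (cayleyGraph G m).Adj 1 (F q) ↔ (cayleyGraph G m).Adj 1 q := by
  have := map_adj_iff F (p := 1) (q := q)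
  rwa [h1] at this

theorem IsStarPair.map {F : GraphAut G m} (h1 : F 1 = 1) {p q : Fin m → G} (H : IsStarPair p q) :
    IsStarPair (F p) (F q) := by
  obtain ⟨v, hp, hq, hv, hv', H⟩ := H
  refine ⟨F v, (map_adj_iff F).mpr hp, (map_adj_iff F).mpr hq,
    fun h => hv (F.injective (h.trans h1.symm)), fun h => hv' ((map_adj_one_iff h1).mp h),
    fun u hu hvu => ?_⟩
  obtain ⟨u, rfl⟩ := F.surjective u
  have := H u ((map_adj_one_iff h1).mp hu) ((map_adj_iff F).mp hvu)
  rwa [map_adj_iff, map_adj_iff, F.injective.eq_iff, F.injective.eq_iff]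

theorem LineLike.map {F : GraphAut G m} (h1 : F 1 = 1) {p q : Fin m → G} (H : LineLike p q) :
    LineLike (F p) (F q) := by
  obtain ⟨hpq, hs, u, v, huv, h⟩ := H
  refine ⟨(map_adj_iff F).mpr hpq, fun h => hs ?_, F u, F v, F.injective.ne huv, ?_⟩
  · have h2 := h.map (inv_fix h1)
    have e : ∀ x, F⁻¹ (F x) = x := fun x => F.symm_apply_apply x
    rwa [e, e] at h2
  · simpa only [map_adj_iff, map_adj_one_iff h1] using h

theorem exists_map_line (hG : ¬ ∀ a b : G, a * b = b * a) {F : GraphAut G m} (h1 : F 1 = 1)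
    {i j a b : Fin (m + 1)} {x y z : G} (hij : i ≠ j) (hab : a ≠ b) (hx : x ≠ 1) (hy : y ≠ 1)
    (hF : F (twoPt i j x) = twoPt a b z) : ∃ z', z' ≠ 1 ∧ F (twoPt i j y) = twoPt a b z' := by
  have step : ∀ {x y z : G}, x ≠ 1 → y ≠ 1 → x ≠ y → y ≠ x⁻¹ → F (twoPt i j x) = twoPt a b z →
      ∃ z', z' ≠ 1 ∧ F (twoPt i j y) = twoPt a b z' := by
    intro x y z hx hy hxy hyx hF
    have hz : z ≠ 1 := by
      rintro rfl
      rw [twoPt_one, ← h1] at hF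
      exact twoPt_ne_one hij hx (F.injective hF)
    have := (lineLike_twoPt (m := m) hG hij hx hy hxy hyx).map h1
    rw [hF] at this
    exact exists_eq_of_lineLike hab hz ((map_adj_one_iff h1).mpr (adj_one_twoPt hij hy)) this
  by_cases hxy : x = y
  · subst hxy
    refine ⟨z, ?_, hF⟩
    rintro rfl
    rw [twoPt_one, ← h1] at hF
    exact twoPt_ne_one hij hx (F.injective hF)
  -- The criterion `LineLike` is not available for the pair `x`, `x⁻¹`, so this case passes through
  -- a third point `w` of the line.
  by_cases hyx : y = x⁻¹
  · obtain ⟨w, -, -, hw, -, hwx, -, hwy, -⟩ := exists_two_avoiding hG x y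
    obtain ⟨z', -, h⟩ := step hx hw hwx.symm (by rwa [← hyx]) hF
    refine step hw hy hwy (fun h => hwx ?_) h
    rw [← inv_inj, ← h, hyx]
  · exact step hx hy hxy hyx hF

/-! ### The permutation of the difference coordinates induced by an automorphism -/

theorem twoPt_support {i j k l : Fin (m + 1)} {x y : G} (hij : i ≠ j) (hkl : k ≠ l) (hx : x ≠ 1)
    (H : (twoPt i j x : Fin m → G) = twoPt k l y) : (i = k ∧ j = l) ∨ (i = l ∧ j = k) := by
  have ei := congrFun (congrArg diff H) i
  have ej := congrFun (congrArg diff H) j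
  rw [diff_twoPt hij, diff_twoPt hkl] at ei ej
  have hx' : x⁻¹ ≠ 1 := by simpa using hx
  grind

theorem exists_third (hm : 1 < m) (i j : Fin (m + 1)) : ∃ k, k ≠ i ∧ k ≠ j := by
  have : ({i, j} : Finset (Fin (m + 1))).card < Fintype.card (Fin (m + 1)) := by
    have := Finset.card_le_two (a := i) (b := j)
    simp only [Fintype.card_fin]
    omega
  obtain ⟨k, hk⟩ := Finset.exists_mem_notMem_of_card_lt_card (t := Finset.univ) this
  exact ⟨k, by simpa using hk.2⟩

theorem exists_preimage {F : GraphAut G m} (h1 : F 1 = 1) {q : Fin m → G}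
    (hq : (cayleyGraph G m).Adj 1 q) : ∃ p, (cayleyGraph G m).Adj 1 p ∧ F p = q := by
  obtain ⟨p, rfl⟩ := F.surjective q
  exact ⟨p, (map_adj_one_iff h1).mp hq, rfl⟩

theorem inv_apply_eq {F : GraphAut G m} {p q : Fin m → G} (h : F p = q) : F⁻¹ q = p := by
  rw [← h]
  exact F.symm_apply_apply p

/-- Distinct lines through the identity are mapped to distinct lines. -/
theorem eq_line_of_map (hG : ¬ ∀ a b : G, a * b = b * a) {F : GraphAut G m} (h1 : F 1 = 1)
    {i j a b : Fin (m + 1)} {x z z' : G} {q : Fin m → G} (hij : i ≠ j) (hab : a ≠ b)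
    (hx : x ≠ 1) (hz' : z' ≠ 1) (hp : F (twoPt i j x) = twoPt a b z) (hq : F q = twoPt a b z') :
    ∃ y, y ≠ 1 ∧ q = twoPt i j y := by
  have hz : z ≠ 1 := by
    rintro rfl
    rw [twoPt_one, ← h1] at hp
    exact twoPt_ne_one hij hx (F.injective hp)
  obtain ⟨y, hy, h⟩ := exists_map_line hG (inv_fix h1) hab hij hz hz' (inv_apply_eq hp)
  exact ⟨y, hy, (inv_apply_eq hq).symm.trans h⟩

/-- Two points of the star lie on different lines, hence so do their images; being adjacent, these
lie on a star with centre `a` and letter `z`. Any further point of the star goes to a common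
neighbour of these two images. -/
theorem exists_map_star (hG : ¬ ∀ a b : G, a * b = b * a) (hm : 1 < m) {F : GraphAut G m}
    (h1 : F 1 = 1) (i : Fin (m + 1)) {x : G} (hx : x ≠ 1) (hxx : x⁻¹ ≠ x) :
    ∃ (a : Fin (m + 1)) (z : G), z ≠ 1 ∧
      ∀ j, j ≠ i → ∃ b, b ≠ a ∧ F (twoPt i j x) = twoPt a b z := by
  obtain ⟨j, hji, -⟩ := exists_third hm i i
  obtain ⟨k, hki, hkj⟩ := exists_third hm i j
  have pairImage : ∃ a b c z, a ≠ b ∧ a ≠ c ∧ b ≠ c ∧ z ≠ 1 ∧ F (twoPt i j x) = twoPt a b z ∧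
      F (twoPt i k x) = twoPt a c z := by
    obtain ⟨a, b, z, hab, hz, hp⟩ :=
      adj_one_iff.mp ((map_adj_one_iff h1).mpr (adj_one_twoPt hji.symm hx))
    have H := (map_adj_iff F).mpr (adj_twoPt_star (m := m) hji.symm hki.symm hkj.symm hx)
    rw [hp] at H
    have hq := (map_adj_one_iff h1).mpr (adj_one_twoPt (m := m) hki.symm hx)
    rcases adj_twoPt_cases hab hz hq H with ⟨y, hy, -, h⟩ | ⟨c, hca, hcb, h⟩ | ⟨c, hca, hcb, h⟩
    · obtain ⟨w, -, hw⟩ := eq_line_of_map hG h1 hji.symm hab hx hy hp h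
      rcases twoPt_support hki.symm hji.symm hx hw with h | h
      · exact absurd h.2 hkj
      · exact absurd h.2 hki
    · exact ⟨a, b, c, z, hab, hca.symm, hcb.symm, hz, hp, h⟩
    · exact ⟨b, a, c, z⁻¹, hab.symm, hcb.symm, hca.symm, by simpa using hz,
        by rw [hp, twoPt_swap hab], h⟩
  obtain ⟨a, b, c, z, hab, hac, hbc, hz, hp, hq⟩ := pairImage
  refine ⟨a, z, hz, fun l hli => ?_⟩
  by_cases hlj : l = j
  · exact ⟨b, hab.symm, hlj ▸ hp⟩
  by_cases hlk : l = k
  · exact ⟨c, hac.symm, hlk ▸ hq⟩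
  have hr := (map_adj_one_iff h1).mpr (adj_one_twoPt (m := m) (Ne.symm hli) hx)
  have hpr := (map_adj_iff F).mpr
    (adj_twoPt_star (m := m) hji.symm (Ne.symm hli) (Ne.symm hlj) hx)
  have hqr := (map_adj_iff F).mpr
    (adj_twoPt_star (m := m) hki.symm (Ne.symm hli) (Ne.symm hlk) hx)
  rw [hp] at hpr
  rw [hq] at hqr
  rcases common_adj_star hab hac hbc hz hr hpr hqr with ⟨d, hd, -, -, h⟩ | ⟨-, hr'⟩
  · exact ⟨d, hd, h⟩
  -- The remaining possibility is the third side of the triangle `a`, `b`, `c`. Four places `i`,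
  -- `j`, `k`, `l` are then present, so there is a place `d` outside the triangle. The preimage of
  -- `twoPt a d z` lies on the original star because `x` is not an involution, hence is equal or
  -- adjacent to `twoPt i l x`; the images are neither.
  exfalso
  obtain ⟨d, hd⟩ : ∃ d, d ∉ ({a, b, c} : Finset (Fin (m + 1))) := by
    have h3 : ({a, b, c} : Finset (Fin (m + 1))).card <
        ({i, j, k, l} : Finset (Fin (m + 1))).card := by
      refine lt_of_le_of_lt Finset.card_le_three ?_
      repeat rw [Finset.card_insert_of_notMem (by simp [*, Ne.symm])]
      simp
    obtain ⟨d, -, hd⟩ := Finset.exists_mem_notMem_of_card_lt_card h3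
    exact ⟨d, hd⟩
  simp only [Finset.mem_insert, Finset.mem_singleton, not_or] at hd
  obtain ⟨hda, hdb, hdc⟩ := hd
  obtain ⟨s, hs, hs'⟩ := exists_preimage h1 (adj_one_twoPt (m := m) (Ne.symm hda) hz)
  have hps : (cayleyGraph G m).Adj (twoPt i j x) s := by
    rw [← map_adj_iff F, hp, hs']
    exact adj_twoPt_star hab (Ne.symm hda) (Ne.symm hdb) hz
  have hqs : (cayleyGraph G m).Adj (twoPt i k x) s := by
    rw [← map_adj_iff F, hq, hs']
    exact adj_twoPt_star hac (Ne.symm hda) (Ne.symm hdc) hz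
  rcases common_adj_star hji.symm hki.symm hkj.symm hx hs hps hqs with
    ⟨l', hl'i, -, -, rfl⟩ | ⟨h, -⟩
  · by_cases hl : l' = l
    · subst hl
      rw [hs'] at hr'
      rcases twoPt_support (Ne.symm hda) hbc hz hr' with h | h
      · exact hab h.1
      · exact hac h.1
    · have := (map_adj_iff F).mpr
        (adj_twoPt_star (m := m) hl'i.symm (Ne.symm hli) hl hx)
      rw [hs', hr'] at this
      exact not_adj_twoPt_of_disjoint (Ne.symm hda) hbc hab hac hdb hdc hz (by simpa using hz) this
  · exact hxx h

/-- The permutation sends `i` to the centre of the image of the star at `i` with letter `x`, for one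
fixed `x` that is not an involution. -/
theorem exists_perm (hG : ¬ ∀ a b : G, a * b = b * a) (hm : 1 < m) {F : GraphAut G m}
    (h1 : F 1 = 1) : ∃ π : Equiv.Perm (Fin (m + 1)), ∀ i j, i ≠ j → ∀ x : G, x ≠ 1 →
      ∃ z, z ≠ 1 ∧ F (twoPt i j x) = twoPt (π i) (π j) z := by
  obtain ⟨x, hxx⟩ := exists_mul_self_ne_one hG
  have hx : x ≠ 1 := by
    rintro rfl
    simp at hxx
  choose π z hz H using fun i => exists_map_star hG hm h1 i hx hxx
  have hπ : Function.Injective π := by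
    intro i j hc
    by_contra hij
    obtain ⟨k, hki, hkj⟩ := exists_third hm i j
    obtain ⟨b, hb, ep⟩ := H i j (Ne.symm hij)
    obtain ⟨b', hb', eq⟩ := H i k hki
    obtain ⟨b'', hb'', er⟩ := H j k hkj
    rw [← hc] at hb'' er
    have hbb' : b ≠ b' := by
      rintro rfl
      rcases twoPt_support hij (Ne.symm hki) hx (F.injective (ep.trans eq.symm)) with h | h
      · exact hkj h.2.symm
      · exact hki h.1.symm
    have hbb'' : b ≠ b'' := by
      rintro rfl
      obtain ⟨y, -, h⟩ := eq_line_of_map hG h1 hij hb.symm hx (hz j) ep er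
      rcases twoPt_support (Ne.symm hkj) hij hx h with h | h
      · exact hij h.1.symm
      · exact hki h.2
    have hb'b'' : b' ≠ b'' := by
      rintro rfl
      obtain ⟨y, -, h⟩ := eq_line_of_map hG h1 (Ne.symm hki) hb'.symm hx (hz j) eq er
      rcases twoPt_support (Ne.symm hkj) (Ne.symm hki) hx h with h | h
      · exact hij h.1.symm
      · exact hkj h.1.symm
    -- If `i` and `j` had the same image centre, this point `s` would lie on the star at `i` and,
    -- since lines go to lines, also on the line through `j` and `k`, which is impossible.
    obtain ⟨s, hs, es⟩ := exists_preimage h1 (adj_one_twoPt (m := m) hb''.symm (hz i))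
    have hps : (cayleyGraph G m).Adj (twoPt i j x) s := by
      rw [← map_adj_iff F, ep, es]
      exact adj_twoPt_star hb.symm hb''.symm hbb'' (hz i)
    have hqs : (cayleyGraph G m).Adj (twoPt i k x) s := by
      rw [← map_adj_iff F, eq, es]
      exact adj_twoPt_star hb'.symm hb''.symm hb'b'' (hz i)
    rcases common_adj_star hij (Ne.symm hki) (Ne.symm hkj) hx hs hps hqs with
      ⟨l, hli, -, -, rfl⟩ | ⟨h, -⟩
    · obtain ⟨y, -, h⟩ := eq_line_of_map hG h1 (Ne.symm hkj) hb''.symm hx (hz i) er es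
      rcases twoPt_support hli.symm (Ne.symm hkj) hx h with h | h
      · exact hij h.1
      · exact hki h.1.symm
    · exact hxx h
  refine ⟨Equiv.ofBijective π (Finite.injective_iff_bijective.mp hπ), fun i j hij y hy => ?_⟩
  simp only [Equiv.ofBijective_apply]
  obtain ⟨b, hb, e⟩ := H i j hij.symm
  obtain ⟨c, hc, e'⟩ := H j i hij
  -- The points `twoPt i j x` and `twoPt j i x` share a line, so the image line has both `π i` and
  -- `π j` among its places.
  obtain ⟨z', hz', e2⟩ := exists_map_line hG h1 hij hb.symm hx (inv_ne_one.mpr hx) e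
  rw [← twoPt_swap hij.symm, e'] at e2
  have hbj : b = π j := by
    rcases twoPt_support hc.symm hb.symm (hz j) e2 with h | h
    · exact absurd (hπ h.1) hij.symm
    · exact h.1.symm
  rw [← hbj]
  exact exists_map_line hG h1 hij hb.symm hx hy e

/-- `F` permutes the difference coordinates of the words of weight two by `π` and acts on the
values by `f`. -/
def ActsBy (F : GraphAut G m) (π : Equiv.Perm (Fin (m + 1))) (f : G → G) : Prop :=
  ∀ i j, i ≠ j → ∀ x, F (twoPt i j x) = twoPt (π i) (π j) (f x)

/-- Adjacency along stars makes the letter map independent of the second place. Exchanging the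
places inverts the letter, which gives independence of the first place too. -/
theorem exists_actsBy (hG : ¬ ∀ a b : G, a * b = b * a) (hm : 1 < m) {F : GraphAut G m}
    (h1 : F 1 = 1) : ∃ π f, ActsBy F π f := by
  obtain ⟨π, H⟩ := exists_perm hG hm h1
  set val : Fin (m + 1) → Fin (m + 1) → G → G := fun i j x => diff (F (twoPt i j x)) (π i)
    with hval
  have hπ : ∀ {i j}, i ≠ j → π i ≠ π j := fun h => π.injective.ne h
  have hF : ∀ i j, i ≠ j → ∀ x, F (twoPt i j x) = twoPt (π i) (π j) (val i j x) := by
    intro i j hij x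
    by_cases hx : x = 1
    · simp only [hval]
      rw [hx, twoPt_one, h1, diff_one, twoPt_one]
    · obtain ⟨z, hz, e⟩ := H i j hij x hx
      simp only [hval]
      rw [e, diff_twoPt (hπ hij), if_pos rfl]
  have val_one : ∀ i j, val i j 1 = 1 := fun i j => by
    simp only [hval]
    rw [twoPt_one, h1, diff_one]
  have val_ne : ∀ i j, i ≠ j → ∀ x, x ≠ 1 → val i j x ≠ 1 := by
    intro i j hij x hx h
    have := hF i j hij x
    rw [h, twoPt_one, ← h1] at this
    exact twoPt_ne_one hij hx (F.injective this)
  have hsnd : ∀ i j k x, i ≠ j → i ≠ k → val i j x = val i k x := by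
    intro i j k x hij hik
    by_cases hx : x = 1
    · rw [hx, val_one, val_one]
    by_cases hjk : j = k
    · rw [hjk]
    have := (map_adj_iff F).mpr (adj_twoPt_star (m := m) hij hik hjk hx)
    rw [hF i j hij, hF i k hik] at this
    exact eq_of_adj_twoPt (hπ hij) (hπ hik) (hπ hjk) (val_ne i j hij x hx) (val_ne i k hik x hx)
      this
  have hswap : ∀ i j x, i ≠ j → val j i x⁻¹ = (val i j x)⁻¹ := by
    intro i j x hij
    have := hF i j hij x
    rw [twoPt_swap hij, hF j i hij.symm, twoPt_swap (hπ hij), twoPt_inj (hπ hij.symm)] at this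
    exact this
  have hfst : ∀ i j k x, i ≠ j → k ≠ j → val i j x = val k j x := by
    intro i j k x hij hkj
    rw [← inv_inj, ← hswap i j x hij, ← hswap k j x hkj]
    exact hsnd j i k _ hij.symm hkj.symm
  have hall : ∀ i j k l x, i ≠ j → k ≠ l → val i j x = val k l x := by
    intro i j k l x hij hkl
    by_cases hli : l = i
    · obtain ⟨t, hti, htj⟩ := exists_third hm i j
      rw [hfst i j t x hij htj, hsnd t j l x htj (hli ▸ hti), hfst t l k x (hli ▸ hti) hkl]
    · rw [hsnd i j l x hij (Ne.symm hli), hfst i l k x (Ne.symm hli) hkl]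
  obtain ⟨t, ht, -⟩ := exists_third hm (0 : Fin (m + 1)) 0
  exact ⟨π, val t 0, fun i j hij x => by rw [hF i j hij, hall i j t 0 x hij ht]⟩

theorem ActsBy.map_one {F : GraphAut G m} {π f} (hm : 1 < m) (h1 : F 1 = 1) (H : ActsBy F π f) :
    f 1 = 1 := by
  obtain ⟨t, ht, -⟩ := exists_third hm (0 : Fin (m + 1)) 0
  have := H t 0 ht 1
  rw [twoPt_one, h1, ← twoPt_one (π t) (π 0), twoPt_inj (π.injective.ne ht)] at this
  exact this.symm

theorem ActsBy.injective {F : GraphAut G m} {π f} (hm : 1 < m) (H : ActsBy F π f) :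
    Function.Injective f := by
  obtain ⟨t, ht, -⟩ := exists_third hm (0 : Fin (m + 1)) 0
  intro x y hxy
  have := (H t 0 ht x).trans ((congrArg _ hxy).trans (H t 0 ht y).symm)
  exact (twoPt_inj ht).mp (F.injective this)

theorem ActsBy.map_inv {F : GraphAut G m} {π f} (hm : 1 < m) (H : ActsBy F π f) (x : G) :
    f x⁻¹ = (f x)⁻¹ := by
  obtain ⟨t, ht, -⟩ := exists_third hm (0 : Fin (m + 1)) 0
  have := H t 0 ht x
  rw [twoPt_swap ht, H 0 t ht.symm, twoPt_swap (π.injective.ne ht),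
    twoPt_inj (π.injective.ne ht.symm)] at this
  exact this

theorem ActsBy.surjective {F : GraphAut G m} {π f} (hm : 1 < m) (h1 : F 1 = 1)
    (H : ActsBy F π f) : Function.Surjective f := by
  obtain ⟨t, ht, -⟩ := exists_third hm (0 : Fin (m + 1)) 0
  have hπ : π t ≠ π 0 := π.injective.ne ht
  intro y
  by_cases hy : y = 1
  · exact ⟨1, by rw [hy, H.map_one hm h1]⟩
  obtain ⟨p, hp, e⟩ := exists_preimage h1 (adj_one_twoPt (m := m) hπ hy)
  obtain ⟨i, j, x, hij, hx, rfl⟩ := adj_one_iff.mp hp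
  rw [H i j hij] at e
  have hfx : f x ≠ 1 := fun h => hx (H.injective hm (h.trans (H.map_one hm h1).symm))
  rcases twoPt_support (π.injective.ne hij) hπ hfx e with h | h
  · rw [h.1, h.2] at e
    exact ⟨x, (twoPt_inj hπ).mp e⟩
  · rw [h.1, h.2, twoPt_swap hπ.symm] at e
    exact ⟨x⁻¹, by rw [H.map_inv hm]; exact (twoPt_inj hπ).mp e⟩

/-! ### Words of weight three -/

/-- A nontrivial letter outside the three places would leave at most one further difference from
each of the six points, which is too few. So `v` has weight exactly three, and each adjacency says
that `v` shares a letter with the given point. -/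
theorem diff_of_adj_six {v : Fin m → G} {i j k : Fin (m + 1)} {α β γ : G} (hij : i ≠ j)
    (hik : i ≠ k) (hjk : j ≠ k) (hα : α ≠ 1) (hαβ : β ≠ α⁻¹) (hβγ : γ ≠ β⁻¹) (hαγ : γ ≠ α⁻¹)
    (hv : v ≠ 1) (hv' : ¬ (cayleyGraph G m).Adj 1 v)
    (h1 : (cayleyGraph G m).Adj v (twoPt i j α)) (h2 : (cayleyGraph G m).Adj v (twoPt i k α))
    (h3 : (cayleyGraph G m).Adj v (twoPt j k β)) (h4 : (cayleyGraph G m).Adj v (twoPt j i β))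
    (h5 : (cayleyGraph G m).Adj v (twoPt k i γ)) (h6 : (cayleyGraph G m).Adj v (twoPt k j γ)) :
    (∀ t, t ≠ i → t ≠ j → t ≠ k → diff v t = 1) ∧
      ((diff v i = α ∧ diff v j = β ∧ diff v k = γ) ∨
        (α = β ∧ β = γ ∧ diff v i = α⁻¹ ∧ diff v j = α⁻¹ ∧ diff v k = α⁻¹)) := by
  have supp : ∀ t, t ≠ i → t ≠ j → t ≠ k → diff v t = 1 := by
    intro t hti htj htk
    by_contra ht
    have e1 := fun a b (hab : a ≠ b) (ha : t ≠ a) (hb : t ≠ b) => diff_eq_of_adj h1 hab ha.symm hb.symm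
    have e2 := fun a b (hab : a ≠ b) (ha : t ≠ a) (hb : t ≠ b) => diff_eq_of_adj h2 hab ha.symm hb.symm
    have e3 := fun a b (hab : a ≠ b) (ha : t ≠ a) (hb : t ≠ b) => diff_eq_of_adj h3 hab ha.symm hb.symm
    have e4 := fun a b (hab : a ≠ b) (ha : t ≠ a) (hb : t ≠ b) => diff_eq_of_adj h4 hab ha.symm hb.symm
    have e5 := fun a b (hab : a ≠ b) (ha : t ≠ a) (hb : t ≠ b) => diff_eq_of_adj h5 hab ha.symm hb.symm
    have e6 := fun a b (hab : a ≠ b) (ha : t ≠ a) (hb : t ≠ b) => diff_eq_of_adj h6 hab ha.symm hb.symm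
    simp only [diff_twoPt hij, diff_twoPt hik, diff_twoPt hjk, diff_twoPt hij.symm,
      diff_twoPt hik.symm, diff_twoPt hjk.symm] at e1 e2 e3 e4 e5 e6
    have vk : diff v k = 1 := by
      have := e1 i k hik hti htk
      have := e4 i k hik hti htk
      grind
    have vi : diff v i = 1 := by
      have := e3 i j hij hti htj
      have := e6 i j hij hti htj
      grind
    have := e1 i k hik hti htk
    have := e1 i j hij hti htj
    grind [inv_eq_one]
  have vi : diff v i ≠ 1 := by
    intro h
    have e := eq_twoPt hjk (g := v) fun t h1 h2 => by
      by_cases hti : t = i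
      · rw [hti, h]
      · exact supp t hti h1 h2
    by_cases h' : diff v j = 1
    · rw [h', twoPt_one] at e; exact hv e
    · exact hv' (e ▸ adj_one_twoPt hjk h')
  have vj : diff v j ≠ 1 := by
    intro h
    have e := eq_twoPt hik (g := v) fun t h1 h2 => by
      by_cases htj : t = j
      · rw [htj, h]
      · exact supp t h1 htj h2
    by_cases h' : diff v i = 1
    · rw [h', twoPt_one] at e; exact hv e
    · exact hv' (e ▸ adj_one_twoPt hik h')
  have vk : diff v k ≠ 1 := by
    intro h
    have e := eq_twoPt hij (g := v) fun t h1 h2 => by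
      by_cases htk : t = k
      · rw [htk, h]
      · exact supp t h1 h2 htk
    by_cases h' : diff v i = 1
    · rw [h', twoPt_one] at e; exact hv e
    · exact hv' (e ▸ adj_one_twoPt hij h')
  refine ⟨supp, ?_⟩
  have e1 := diff_eq_of_adj h1 hij hik hjk
  have e2 := diff_eq_of_adj h2 hij hik hjk
  have e3 := diff_eq_of_adj h3 hij hik hjk
  have e4 := diff_eq_of_adj h4 hij hik hjk
  have e5 := diff_eq_of_adj h5 hij hik hjk
  have e6 := diff_eq_of_adj h6 hij hik hjk
  simp only [diff_twoPt hij, diff_twoPt hik, diff_twoPt hjk, diff_twoPt hij.symm,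
    diff_twoPt hik.symm, diff_twoPt hjk.symm, if_true, if_neg hij, if_neg hik, if_neg hjk,
    if_neg hij.symm, if_neg hik.symm, if_neg hjk.symm, vi, vj, vk, false_or, or_false]
    at e1 e2 e3 e4 e5 e6
  by_cases hi : diff v i = α
  · left
    grind [inv_inv]
  -- One failure `diff v i ≠ α` forces the inverse letter in every other alternative, and all three
  -- letters coincide.
  · right
    have a1 : diff v j = α⁻¹ := by grind
    have a2 : diff v k = α⁻¹ := by grind
    have a3 : diff v j ≠ β := by grind
    have a4 : diff v i = β⁻¹ := by grind
    have a5 : diff v k = β⁻¹ := by grind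
    have a6 : diff v j = γ⁻¹ := by grind
    have b1 : α = β := inv_injective (a2.symm.trans a5)
    have b2 : α = γ := inv_injective (a1.symm.trans a6)
    subst b1 b2
    exact ⟨rfl, rfl, a4, a1, a2⟩

/-- The images of words of weight three. -/
theorem ActsBy.exists_three {F : GraphAut G m} {π f} (hm : 1 < m) (h1 : F 1 = 1)
    (H : ActsBy F π f) {i j k : Fin (m + 1)} (hij : i < j) (hjk : j < k) {a b : G} (ha : a ≠ 1)
    (hb : b ≠ 1) (hab : a * b ≠ 1) : ∃ v : Fin m → G,
    (∀ t, t ≠ π i → t ≠ π j → t ≠ π k → diff v t = 1) ∧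
      ((diff v (π i) = f a ∧ diff v (π j) = f b ∧ diff v (π k) = f (a * b)⁻¹) ∨
        (f a = f b ∧ f b = f (a * b)⁻¹ ∧ diff v (π i) = (f a)⁻¹ ∧ diff v (π j) = (f a)⁻¹ ∧
          diff v (π k) = (f a)⁻¹)) := by
  obtain ⟨v, vi, vj, vk, vt⟩ := GenericCayley.exists_three (m := m) hij hjk a b
  have hij' := hij.ne
  have hjk' := hjk.ne
  have hik' := (hij.trans hjk).ne
  have hπ : ∀ {s t}, s ≠ t → π s ≠ π t := fun h => π.injective.ne h
  have hc : (a * b)⁻¹ ≠ 1 := inv_ne_one.mpr hab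
  have hinj : ∀ {x y}, x ≠ y⁻¹ → f x ≠ (f y)⁻¹ := fun h => by
    rw [← H.map_inv hm]; exact (H.injective hm).ne h
  have hadj : ∀ {s t r : Fin (m + 1)} {x : G}, s ≠ t → r ≠ s → r ≠ t → diff v s = x →
      diff v r ≠ 1 → (∀ u, u ≠ s → u ≠ t → u ≠ r → diff v u = 1) →
      (cayleyGraph G m).Adj (F v) (twoPt (π s) (π t) (f x)) := by
    intro s t r x hst hrs hrt hs hr hu
    rw [← H s t hst, map_adj_iff]
    refine adj_of_diff_eq (i := r) (j := t) (fun h => ?_) hrt fun u h1 h2 => ?_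
    · rw [h, diff_twoPt hst] at hr
      simp [hrs, hrt] at hr
    · rw [diff_twoPt hst]
      grind
  have hv : v ≠ 1 := by
    rintro rfl
    rw [diff_one] at vi
    exact ha vi.symm
  refine ⟨F v, diff_of_adj_six (hπ hij') (hπ hik') (hπ hjk') ?_ ?_ ?_ ?_ ?_ ?_
    ?_ ?_ ?_ ?_ ?_ ?_⟩
  · rw [← H.map_one hm h1]; exact (H.injective hm).ne ha
  · exact hinj fun h => hab (by rw [h, mul_inv_cancel])
  · exact hinj fun h => ha (by simpa using h)
  · exact hinj fun h => hb (by simpa using h)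
  · exact fun h => hv (F.injective (h.trans h1.symm))
  · rw [map_adj_one_iff h1]
    intro h
    have := diff_eq_of_adj h hij' hik' hjk'
    simp only [diff_one] at this
    grind
  · exact hadj hij' hik'.symm hjk'.symm vi (vk ▸ hc) fun u h1 h2 h3 => vt u h1 h2 h3
  · exact hadj hik' hij'.symm hjk' vi (vj ▸ hb) fun u h1 h2 h3 => vt u h1 h3 h2
  · exact hadj hjk' hij' hik' vj (vi ▸ ha) fun u h1 h2 h3 => vt u h3 h1 h2
  · exact hadj hij'.symm hjk'.symm hik'.symm vj (vk ▸ hc) fun u h1 h2 h3 => vt u h2 h1 h3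
  · exact hadj hik'.symm hjk' hij'.symm vk (vj ▸ hb) fun u h1 h2 h3 => vt u h2 h3 h1
  · exact hadj hjk'.symm hik' hij' vk (vi ▸ ha) fun u h1 h2 h3 => vt u h3 h2 h1

/-- The word `a, b, (ab)⁻¹` is mapped to a word whose letters multiply to 1 in the order of the new
places. A relation `αβγ = 1` survives cyclic shifts, so only the cyclic order matters. In the
exceptional case all three letters equal `(f a)⁻¹`, the relation says that `f a` has cube 1, and the
same identity results. -/
theorem ActsBy.mul_cases {F : GraphAut G m} {π f} (hm : 1 < m) (h1 : F 1 = 1)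
    (H : ActsBy F π f) {i j k : Fin (m + 1)} (hij : i < j) (hjk : j < k) :
    (((π i < π j ∧ π j < π k) ∨ (π j < π k ∧ π k < π i) ∨ (π k < π i ∧ π i < π j)) →
      ∀ a b, f (a * b) = f a * f b) ∧
    (((π i < π k ∧ π k < π j) ∨ (π k < π j ∧ π j < π i) ∨ (π j < π i ∧ π i < π k)) →
      ∀ a b, f (a * b) = f b * f a) := by
  have triv : ∀ a b, a = 1 ∨ b = 1 ∨ a * b = 1 → f (a * b) = f a * f b ∧ f (a * b) = f b * f a := by
    rintro a b (rfl | rfl | h)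
    · simp [H.map_one hm h1]
    · simp [H.map_one hm h1]
    · have : b = a⁻¹ := (eq_inv_of_mul_eq_one_right h)
      subst this
      simp [H.map_one hm h1, H.map_inv hm]
  constructor
  · intro hc a b
    by_cases ht : a = 1 ∨ b = 1 ∨ a * b = 1
    · exact (triv a b ht).1
    push Not at ht
    obtain ⟨v, vt, hv⟩ := H.exists_three hm h1 hij hjk ht.1 ht.2.1 ht.2.2
    rw [H.map_inv hm] at hv
    have key : f a * f b * (f (a * b))⁻¹ = 1 := by
      rcases hc with ⟨e1, e2⟩ | ⟨e1, e2⟩ | ⟨e1, e2⟩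
      · have := diff_mul_diff_mul_diff e1 e2 (g := v) fun t h1 h2 h3 => vt t h1 h2 h3
        rcases hv with ⟨x, y, z⟩ | ⟨x, y, z, w, u⟩
        · rwa [x, y, z] at this
        · rw [← y, ← x]
          rw [z, w, u] at this
          simpa [mul_assoc] using congrArg (·⁻¹) this
      · have := diff_mul_diff_mul_diff e1 e2 (g := v) fun t h1 h2 h3 => vt t h3 h1 h2
        rcases hv with ⟨x, y, z⟩ | ⟨x, y, z, w, u⟩
        · rw [x, y, z] at this
          rwa [mul_eq_one_comm, ← mul_assoc] at this
        · rw [← y, ← x]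
          rw [z, w, u] at this
          simpa [mul_assoc] using congrArg (·⁻¹) this
      · have := diff_mul_diff_mul_diff e1 e2 (g := v) fun t h1 h2 h3 => vt t h2 h3 h1
        rcases hv with ⟨x, y, z⟩ | ⟨x, y, z, w, u⟩
        · rw [x, y, z] at this
          rwa [mul_assoc, mul_eq_one_comm] at this
        · rw [← y, ← x]
          rw [z, w, u] at this
          simpa [mul_assoc] using congrArg (·⁻¹) this
    exact (mul_inv_eq_one.mp key).symm
  · intro hc a b
    by_cases ht : a = 1 ∨ b = 1 ∨ a * b = 1
    · exact (triv a b ht).2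
    push Not at ht
    obtain ⟨v, vt, hv⟩ := H.exists_three hm h1 hij hjk ht.1 ht.2.1 ht.2.2
    rw [H.map_inv hm] at hv
    have key : f b * f a * (f (a * b))⁻¹ = 1 := by
      rcases hc with ⟨e1, e2⟩ | ⟨e1, e2⟩ | ⟨e1, e2⟩
      · have := diff_mul_diff_mul_diff e1 e2 (g := v) fun t h1 h2 h3 => vt t h1 h3 h2
        rcases hv with ⟨x, y, z⟩ | ⟨x, y, z, w, u⟩
        · rw [x, y, z] at this
          rwa [mul_eq_one_comm, ← mul_assoc] at this
        · rw [← y, ← x]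
          rw [z, w, u] at this
          simpa [mul_assoc] using congrArg (·⁻¹) this
      · have := diff_mul_diff_mul_diff e1 e2 (g := v) fun t h1 h2 h3 => vt t h3 h2 h1
        rcases hv with ⟨x, y, z⟩ | ⟨x, y, z, w, u⟩
        · rw [x, y, z] at this
          rwa [mul_assoc, mul_eq_one_comm] at this
        · rw [← y, ← x]
          rw [z, w, u] at this
          simpa [mul_assoc] using congrArg (·⁻¹) this
      · have := diff_mul_diff_mul_diff e1 e2 (g := v) fun t h1 h2 h3 => vt t h2 h1 h3
        rcases hv with ⟨x, y, z⟩ | ⟨x, y, z, w, u⟩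
        · rwa [x, y, z] at this
        · rw [← y, ← x]
          rw [z, w, u] at this
          simpa [mul_assoc] using congrArg (·⁻¹) this
    exact (mul_inv_eq_one.mp key).symm

theorem ActsBy.hom_or_antihom {F : GraphAut G m} {π f} (hm : 1 < m) (h1 : F 1 = 1)
    (H : ActsBy F π f) : (∀ a b, f (a * b) = f a * f b) ∨ (∀ a b, f (a * b) = f b * f a) := by
  have hij : (⟨0, by omega⟩ : Fin (m + 1)) < ⟨1, by omega⟩ := Fin.mk_lt_mk.mpr (by omega)
  have hjk : (⟨1, by omega⟩ : Fin (m + 1)) < ⟨2, by omega⟩ := Fin.mk_lt_mk.mpr (by omega)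
  have h := H.mul_cases hm h1 hij hjk
  have e1 := π.injective.ne hij.ne
  have e2 := π.injective.ne hjk.ne
  have e3 := π.injective.ne (hij.trans hjk).ne
  generalize π ⟨0, _⟩ = x at *
  generalize π ⟨1, _⟩ = y at *
  generalize π ⟨2, _⟩ = z at *
  by_cases hc : (x < y ∧ y < z) ∨ (y < z ∧ z < x) ∨ (z < x ∧ x < y)
  · exact Or.inl (h.1 hc)
  · refine Or.inr (h.2 ?_)
    clear h
    rcases e1.lt_or_gt with h1 | h1 <;> rcases e2.lt_or_gt with h2 | h2 <;>
      rcases e3.lt_or_gt with h3 | h3 <;> simp_all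

/-- If `π` fixed 0 and inverted `j < k`, it would reverse the cyclic order of `0, j, k`. Then `f`
would be surjective and both multiplicative and antimultiplicative, making `G` abelian. -/
theorem ActsBy.perm_eq_one {F : GraphAut G m} {π f} (hG : ¬ ∀ a b : G, a * b = b * a)
    (hm : 1 < m) (h1 : F 1 = 1) (H : ActsBy F π f) (hf : ∀ a b, f (a * b) = f a * f b)
    (h0 : π 0 = 0) : π = 1 := by
  have mono : StrictMono π := by
    intro j k hjk
    rcases eq_or_ne j 0 with rfl | hj
    · rw [h0]
      refine Fin.pos_of_ne_zero fun h => hjk.ne' (π.injective (h.trans h0.symm))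
    · by_contra hlt
      have hlt' : π k < π j := lt_of_le_of_ne (not_lt.mp hlt) (π.injective.ne hjk.ne')
      have hk : 0 < π k := Fin.pos_of_ne_zero fun h => by
        have := π.injective (h.trans h0.symm)
        subst this
        exact absurd hjk (Fin.not_lt_zero _)
      have := (H.mul_cases hm h1 (Fin.pos_of_ne_zero hj) hjk).2 (Or.inl ⟨by rwa [h0], hlt'⟩)
      refine hG fun a b => ?_
      obtain ⟨a, rfl⟩ := H.surjective hm h1 a
      obtain ⟨b, rfl⟩ := H.surjective hm h1 b
      rw [← hf, this]
  have h := mono.range_inj strictMono_id |>.mp (by simp [π.surjective.range_eq])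
  exact Equiv.ext fun i => congrFun h i

/-! ### The known automorphisms in difference coordinates -/

theorem path_omegaFun (g : Fin m → G) {t : ℕ} (ht : t ≤ m) :
    path (omegaFun g) t = (prolong g 0)⁻¹ * path g (t + 1) := by
  rcases t with _ | t
  · simp [path_succ]
  · rw [path_succ, path_succ, prolong_of_lt _ (by omega)]
    rfl

/-- The common left factor in `omegaFun` cancels in every quotient. At the last place the index
wraps around to 0 because both paths end at 1. -/
theorem diff_omegaFun (g : Fin m → G) (i : Fin (m + 1)) :
    diff (omegaFun g) i = diff g (i + 1) := by
  rcases eq_or_ne i (Fin.last m) with rfl | hi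
  · rw [Fin.last_add_one, diff, diff, Fin.val_last, Fin.val_zero, path_omegaFun g le_rfl,
      path_of_lt _ (Nat.lt_succ_self m), path_of_lt _ (Nat.lt_succ_self m)]
    simp [path_succ]
  · have hi' : (i : ℕ) < m := Fin.val_lt_last hi
    rw [diff, diff, Fin.val_add_one_of_lt (Fin.lt_last_iff_ne_last.mpr hi),
      path_omegaFun g hi'.le, path_omegaFun g hi']
    group

theorem path_tauFun (g : Fin m → G) {t : ℕ} (ht : t ≤ m + 1) :
    path (tauFun g) t = path g (m + 1 - t) := by
  rcases t with _ | t
  · rw [path_of_lt g (by omega), path_zero]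
  · rw [path_succ]
    rcases Nat.lt_or_ge t m with h | h
    · rw [prolong_of_lt _ h, show m + 1 - (t + 1) = (m - 1 - t) + 1 by omega, path_succ,
        prolong_of_lt _ (by omega)]
      refine congrArg g (Fin.ext ?_)
      simp only [Fin.val_rev]
      omega
    · rw [prolong_of_ge _ h, show m + 1 - (t + 1) = 0 by omega, path_zero]

theorem diff_tauFun (g : Fin m → G) (i : Fin (m + 1)) :
    diff (tauFun g) i = (diff g i.rev)⁻¹ := by
  have hi := i.isLt
  rw [diff, diff, path_tauFun g hi.le, path_tauFun g (by omega), Fin.val_rev,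
    show m + 1 - (i : ℕ) = m + 1 - (i + 1) + 1 by omega]
  group

theorem diff_coordAction (f : MulAut G) (g : Fin m → G) (i : Fin (m + 1)) :
    diff (coordAction G m f g) i = f (diff g i) := by
  have : ∀ t, path (coordAction G m f g) t = f (path g t) := by
    intro t
    rcases t with _ | t
    · simp
    · rw [path_succ, path_succ, prolong, prolong]
      split_ifs <;> simp
  simp [diff, this]

theorem omega_one_apply : omega G m 1 = 1 :=
  diff_injective (funext fun i => by simp [diff_omegaFun])

theorem tau_one_apply : tau G m 1 = 1 :=
  diff_injective (funext fun i => by simp [diff_tauFun])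

theorem coordAut_one_apply (f : MulAut G) : coordAut G m f 1 = 1 := map_one (coordAction G m f)

theorem actsBy_one : ActsBy (1 : GraphAut G m) 1 id := fun _ _ _ _ => rfl

theorem ActsBy.mul {F F' : GraphAut G m} {π π' f f'} (H : ActsBy F π f) (H' : ActsBy F' π' f') :
    ActsBy (F' * F) (π' * π) (f' ∘ f) := fun i j hij x => by
  rw [RelIso.mul_apply, H i j hij, H' _ _ (π.injective.ne hij)]
  rfl

theorem actsBy_omega : ActsBy (omega G m) (Equiv.subRight 1) id := by
  intro i j hij x
  apply diff_injective
  funext t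
  rw [omega_apply, diff_omegaFun, diff_twoPt hij, diff_twoPt ((Equiv.injective _).ne hij)]
  simp [eq_sub_iff_add_eq]

theorem actsBy_omega_pow (k : ℕ) :
    ActsBy (omega G m ^ k) (Equiv.subRight (Fin.ofNat (m + 1) k)) id := by
  induction k with
  | zero =>
    have : Equiv.subRight (Fin.ofNat (m + 1) 0) = 1 := Equiv.ext fun i => by simp
    rw [pow_zero, this]
    exact actsBy_one
  | succ k ih =>
    have h := ih.mul actsBy_omega
    have e : Fin.ofNat (m + 1) (k + 1) = Fin.ofNat (m + 1) k + 1 := by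
      ext
      simp [Fin.val_add]
    have e' : Equiv.subRight 1 * Equiv.subRight (Fin.ofNat (m + 1) k) =
        Equiv.subRight (Fin.ofNat (m + 1) (k + 1)) := Equiv.ext fun i => by
      rw [e]
      exact sub_sub i (Fin.ofNat (m + 1) k) 1
    rw [pow_succ', ← e']
    exact h

theorem actsBy_tau : ActsBy (tau G m) Fin.revPerm (·⁻¹) := by
  intro i j hij x
  apply diff_injective
  funext t
  rw [tau_apply, diff_tauFun, diff_twoPt hij, diff_twoPt ((Equiv.injective _).ne hij)]
  simp only [Fin.revPerm_apply, Fin.rev_eq_iff]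
  split_ifs <;> simp

theorem actsBy_coordAut (f : MulAut G) : ActsBy (coordAut G m f) 1 f := by
  intro i j hij x
  apply diff_injective
  funext t
  change diff (coordAction G m f _) t = _
  rw [diff_coordAction, diff_twoPt hij, diff_twoPt ((Equiv.injective _).ne hij)]
  change f _ = if t = i then f x else if t = j then (f x)⁻¹ else 1
  split_ifs <;> simp

/-! ### An automorphism is determined by its values near the identity -/

theorem twoPt_mul_exists (i j : Fin (m + 1)) (x y : G) :
    ∃ w, twoPt i j x * twoPt i j y = (twoPt i j w : Fin m → G) := by
  by_cases h : i < j
  · exact ⟨_, twoPt_mul i j x y h⟩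
  · exact ⟨y * x, by simp [twoPt, h, block_mul]⟩

theorem translation_inv_apply (a x : Fin m → G) : (translation G m a)⁻¹ x = x * a := by
  rw [← map_inv, translation_apply, inv_inv]

/-- Translating `p` to the identity gives `F'`, which acts by some `π` and `f`. The fixed points of
`F` near both the identity and `p` suffice to force `π = 1` and `f = id`. -/
theorem fix_nbhd_twoPt (hG : ¬ ∀ a b : G, a * b = b * a) (hm : 1 < m) {F : GraphAut G m}
    (H : ∀ p, (cayleyGraph G m).Adj 1 p → F p = p) {p : Fin m → G}
    (hp : (cayleyGraph G m).Adj 1 p) (h1 : F 1 = 1) {q : Fin m → G}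
    (hq : (cayleyGraph G m).Adj p q) : F q = q := by
  set F' := translation G m p * F * (translation G m p)⁻¹ with hF'
  have hF'a : ∀ y, F' y = F (y * p) * p⁻¹ := fun y => by
    rw [hF', RelIso.mul_apply, RelIso.mul_apply, translation_inv_apply, translation_apply]
  have hfix : ∀ y, F y = y → F' (y * p⁻¹) = y * p⁻¹ := fun y hy => by
    rw [hF'a, inv_mul_cancel_right, hy]
  have hF'1 : F' 1 = 1 := by simpa using hfix p (H p hp)
  obtain ⟨π, f, hA⟩ := exists_actsBy hG hm hF'1
  obtain ⟨i, j, x, hij, hx, rfl⟩ := adj_one_iff.mp hp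
  have hF2 : ∀ a b, a ≠ b → ∀ x : G, F (twoPt a b x) = twoPt a b x := fun a b hab x => by
    by_cases hx : x = 1
    · rw [hx, twoPt_one, h1]
    · exact H _ (adj_one_twoPt hab hx)
  -- The line through the identity and `p` is stable under right multiplication by `p`, so `F'`
  -- fixes it pointwise; this yields `f = id`.
  have hline : ∀ z, F' (twoPt i j z) = twoPt i j z := fun z => by
    obtain ⟨w, hw⟩ := twoPt_mul_exists (m := m) i j z x
    rw [hF'a, hw, hF2 i j hij, ← hw, mul_inv_cancel_right]
  have supp : ∀ {a b z}, a ≠ b → z ≠ 1 → F' (twoPt a b z) = twoPt a b z →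
      (π a = a ∧ π b = b) ∨ (π a = b ∧ π b = a) := by
    intro a b z hab hz h
    rw [hA a b hab] at h
    rcases twoPt_support hab (π.injective.ne hab) hz h.symm with h | h
    · exact Or.inl ⟨h.1.symm, h.2.symm⟩
    · exact Or.inr ⟨h.2.symm, h.1.symm⟩
  -- A point of a star through `p` differs from `p` at `b` and `c`, so its translate is a fixed
  -- point of `F'` on the line of `b` and `c`. Thus `π` preserves this pair; the three pairs from
  -- `i`, `j`, `k` together pin down all three places.
  have side : ∀ {a b c : Fin (m + 1)} {y : G}, a ≠ b → a ≠ c → b ≠ c → y ≠ 1 →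
      twoPt i j x = (twoPt a b y : Fin m → G) → (π b = b ∧ π c = c) ∨ (π b = c ∧ π c = b) := by
    intro a b c y hab hac hbc hy e
    have e1 : ∀ t, t ≠ b → t ≠ c → diff (twoPt a c y * (twoPt i j x)⁻¹) t = 1 := by
      intro t h1 h2
      have : diff (twoPt a c y * (twoPt i j x)⁻¹) t = diff (twoPt i j x * (twoPt i j x)⁻¹) t := by
        rw [diff_mul_eq_iff, e, diff_twoPt hab, diff_twoPt hac]
        simp [h1, h2]
      rw [this, mul_inv_cancel, diff_one]
    have e2 := eq_twoPt hbc e1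
    have e3 := hfix _ (hF2 a c hac y)
    rw [e2] at e3
    refine supp hbc (fun h => ?_) e3
    rw [h, twoPt_one, mul_inv_eq_one, e] at e2
    have := congrFun (congrArg diff e2) c
    rw [diff_twoPt hac, diff_twoPt hab] at this
    simp [hac.symm, hbc.symm, hy] at this
  have hx' : x⁻¹ ≠ 1 := by simpa using hx
  have hπ : ∀ k, k ≠ i → k ≠ j → π i = i ∧ π j = j ∧ π k = k := by
    intro k hki hkj
    have s1 := supp hij hx (hline x)
    have s2 := side hij (Ne.symm hki) (Ne.symm hkj) hx rfl
    have s3 := side hij.symm (Ne.symm hkj) (Ne.symm hki) hx' (twoPt_swap hij x)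
    grind
  have hπ' : ∀ k, π k = k := by
    intro k
    obtain ⟨l, hli, hlj⟩ := exists_third hm i j
    by_cases hki : k = i
    · exact hki ▸ (hπ l hli hlj).1
    by_cases hkj : k = j
    · exact hkj ▸ (hπ l hli hlj).2.1
    exact (hπ k hki hkj).2.2
  have hf : ∀ z, f z = z := fun z => by
    have := hline z
    rwa [hA i j hij, hπ', hπ', twoPt_inj hij] at this
  have hq' : (cayleyGraph G m).Adj 1 (q * (twoPt i j x)⁻¹) := by
    have := adj_mul_right (twoPt i j x)⁻¹ _ _ hq
    rwa [mul_inv_cancel] at this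
  obtain ⟨a, b, y, hab, hy, e⟩ := adj_one_iff.mp hq'
  have := hA a b hab y
  rw [hf, hπ', hπ', ← e, hF'a, inv_mul_cancel_right] at this
  exact mul_right_cancel this

theorem closure_canonicalSet : Subgroup.closure (canonicalSet G m) = ⊤ := by
  refine (Subgroup.eq_top_iff' _).mpr fun g => ?_
  refine Subgroup.pi_mem_of_mulSingle_mem g fun i => ?_
  have e : Pi.mulSingle i (g i) = block m i (i + 1) (g i) := by
    funext j
    simp only [Pi.mulSingle_apply, block, Fin.ext_iff]
    exact if_congr (by omega) rfl rfl
  by_cases h : g i = 1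
  · rw [h, Pi.mulSingle_one]
    exact one_mem _
  · exact Subgroup.subset_closure ⟨i, i + 1, by omega, i.isLt, g i, h, e⟩

/-- The graph is connected, and by `fix_nbhd_twoPt` the property of fixing a vertex and all its
neighbours passes along edges. -/
theorem eq_one_of_fix (hG : ¬ ∀ a b : G, a * b = b * a) (hm : 1 < m) {F : GraphAut G m}
    (h1 : F 1 = 1) (H : ∀ p, (cayleyGraph G m).Adj 1 p → F p = p) : F = 1 := by
  have step : ∀ g h, (cayleyGraph G m).Adj g h →
      (F g = g ∧ ∀ q, (cayleyGraph G m).Adj g q → F q = q) →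
      (F h = h ∧ ∀ q, (cayleyGraph G m).Adj h q → F q = q) := by
    rintro g h hgh ⟨hg, hN⟩
    refine ⟨hN h hgh, fun q hq => ?_⟩
    set F' := translation G m g * F * (translation G m g)⁻¹ with hF'
    have hF'a : ∀ y, F' y = F (y * g) * g⁻¹ := fun y => by
      rw [hF', RelIso.mul_apply, RelIso.mul_apply, translation_inv_apply, translation_apply]
    have hF'1 : F' 1 = 1 := by rw [hF'a, one_mul, hg, mul_inv_cancel]
    have hF'N : ∀ p, (cayleyGraph G m).Adj 1 p → F' p = p := fun p hp => by
      have := adj_mul_right g _ _ hp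
      rw [one_mul] at this
      rw [hF'a, hN _ this, mul_inv_cancel_right]
    have hh : (cayleyGraph G m).Adj 1 (h * g⁻¹) := by
      have := adj_mul_right g⁻¹ _ _ hgh
      rwa [mul_inv_cancel] at this
    have := fix_nbhd_twoPt hG hm hF'N hh hF'1 (adj_mul_right g⁻¹ _ _ hq)
    rw [hF'a, inv_mul_cancel_right] at this
    exact mul_right_cancel this
  have all : ∀ g : Fin m → G, F g = g ∧ ∀ q, (cayleyGraph G m).Adj g q → F q = q := by
    intro g
    have hg : g ∈ Subgroup.closure (canonicalSet G m) := by
      rw [closure_canonicalSet]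
      trivial
    induction hg using Subgroup.closure_induction_left with
    | one => exact ⟨h1, H⟩
    | mul_left s hs g _ ih => exact step g _ ⟨s, hs, rfl⟩ ih
    | inv_mul_cancel s hs g _ ih => exact step g _ ⟨s⁻¹, inv_mem_canonicalSet hs, rfl⟩ ih
  exact RelIso.ext fun g => (all g).1

/-- An automorphism that fixes the identity and every line through it is induced by an
automorphism of `G`. -/
theorem ActsBy.mem_range_coordAut (hG : ¬ ∀ a b : G, a * b = b * a) (hm : 1 < m)
    {F : GraphAut G m} {f} (h1 : F 1 = 1) (H : ActsBy F 1 f) : F ∈ (coordAut G m).range := by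
  have hij : (⟨0, by omega⟩ : Fin (m + 1)) < ⟨1, by omega⟩ := Fin.mk_lt_mk.mpr (by omega)
  have hjk : (⟨1, by omega⟩ : Fin (m + 1)) < ⟨2, by omega⟩ := Fin.mk_lt_mk.mpr (by omega)
  have hf := (H.mul_cases hm h1 hij hjk).1 (Or.inl ⟨hij, hjk⟩)
  let φ : MulAut G := MulEquiv.ofBijective (MonoidHom.mk' f hf)
    ⟨H.injective hm, H.surjective hm h1⟩
  refine ⟨φ, ?_⟩
  have e : F⁻¹ * coordAut G m φ = 1 := by
    refine eq_one_of_fix hG hm ?_ fun p hp => ?_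
    · rw [RelIso.mul_apply, coordAut_one_apply, inv_fix h1]
    · obtain ⟨i, j, x, hij, hx, rfl⟩ := adj_one_iff.mp hp
      rw [RelIso.mul_apply, actsBy_coordAut φ i j hij]
      exact inv_apply_eq (H i j hij x)
  exact (inv_mul_eq_one.mp e).symm

theorem omega_mem : omega G m ∈ dihedralSubgroup G m := Subgroup.subset_closure (by simp)

theorem tau_mem : tau G m ∈ dihedralSubgroup G m := Subgroup.subset_closure (by simp)

theorem omega_pow_apply_one (k : ℕ) : (omega G m ^ k) 1 = 1 := by
  induction k with
  | zero => rfl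
  | succ k ih => rw [pow_succ', RelIso.mul_apply, ih, omega_one_apply]

/-- The stabilizer of the identity. -/
theorem exists_dihedral_mul_mem (hG : ¬ ∀ a b : G, a * b = b * a) (hm : 1 < m)
    {F : GraphAut G m} (h1 : F 1 = 1) :
    ∃ d ∈ dihedralSubgroup G m, d * F ∈ (coordAut G m).range := by
  have main : ∀ {F : GraphAut G m} {π f}, F 1 = 1 → ActsBy F π f →
      (∀ a b, f (a * b) = f a * f b) →
      ∃ d ∈ dihedralSubgroup G m, d * F ∈ (coordAut G m).range := by
    intro F π f h1 H hf
    have h1' : (omega G m ^ (π 0 : ℕ) * F) 1 = 1 := by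
      rw [RelIso.mul_apply, h1, omega_pow_apply_one]
    -- Rotating by `π 0` brings the image of place 0 back to 0.
    have H' := H.mul (actsBy_omega_pow (G := G) (π 0 : ℕ))
    have e := H'.perm_eq_one hG hm h1' hf (by
      change π 0 - Fin.ofNat (m + 1) (π 0 : ℕ) = 0
      rw [Fin.ofNat_val_eq_self, sub_self])
    rw [e] at H'
    exact ⟨_, pow_mem omega_mem _, H'.mem_range_coordAut hG hm h1'⟩
  obtain ⟨π, f, H⟩ := exists_actsBy hG hm h1
  rcases H.hom_or_antihom hm h1 with hf | hf
  · exact main h1 H hf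
  -- Since `τ` inverts letters, it turns an antihomomorphism into a homomorphism.
  · obtain ⟨d, hd, h⟩ := main (F := tau G m * F) (by rw [RelIso.mul_apply, h1, tau_one_apply])
      (H.mul actsBy_tau) fun a b => by simp [hf]
    exact ⟨d * tau G m, mul_mem hd tau_mem, by rwa [mul_assoc]⟩

/-! ### The dihedral group inside the automorphism group -/

/-- The homomorphism from a dihedral group that is given by the images of the rotation `r 1` and of
the reflection `sr 0`. -/
def dihedralLift {Γ : Type*} [Group Γ] {n : ℕ} [NeZero n] (a b : Γ) (ha : a ^ n = 1)
    (hb : b * b = 1) (hab : b * a * b = a⁻¹) : DihedralGroup n →* Γ :=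
  have add : ∀ i j : ZMod n, a ^ (i + j).val = a ^ i.val * a ^ j.val := fun i j => by
    rw [ZMod.val_add, ← pow_eq_pow_mod _ ha, pow_add]
  have neg : ∀ i : ZMod n, a ^ (-i).val = (a ^ i.val)⁻¹ := fun i => by
    rw [eq_inv_iff_mul_eq_one, ← add, neg_add_cancel, ZMod.val_zero, pow_zero]
  have flip : ∀ k : ℕ, a ^ k * b = b * (a ^ k)⁻¹ := fun k => by
    have h : b⁻¹ = b := inv_eq_of_mul_eq_one_left hb
    have := conj_pow (i := k) (a := b) (b := a)
    rw [h, hab] at this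
    rw [← inv_pow, this, ← mul_assoc, ← mul_assoc, hb, one_mul]
  MonoidHom.mk' (fun g => match g with
      | .r i => a ^ i.val
      | .sr i => b * a ^ i.val) (by
    rintro (i | i) (j | j)
    · exact add i j
    · change b * a ^ (j - i).val = a ^ i.val * (b * a ^ j.val)
      rw [← mul_assoc, flip, mul_assoc, ← neg, ← add, neg_add_eq_sub]
    · change b * a ^ (i + j).val = b * a ^ i.val * a ^ j.val
      rw [add, mul_assoc]
    · change a ^ (j - i).val = b * a ^ i.val * (b * a ^ j.val)
      rw [mul_assoc b, ← mul_assoc (a ^ i.val), flip, mul_assoc b, ← mul_assoc b, hb, one_mul,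
        ← neg, ← add, neg_add_eq_sub])

theorem tau_mul_tau : tau G m * tau G m = 1 := RelIso.ext fun g => tauFun_tauFun g

theorem tau_omega_tau : tau G m * omega G m * tau G m = (omega G m)⁻¹ := by
  rw [eq_inv_iff_mul_eq_one]
  refine RelIso.ext fun g => ?_
  change tauFun (omegaFun (tauFun (omegaFun g))) = g
  rw [omegaFun_tau_omegaFun, tauFun_tauFun]

/-- A rotation by `m + 1` places fixes all words of weight two, so rigidity applies. -/
theorem omega_pow (hG : ¬ ∀ a b : G, a * b = b * a) (hm : 1 < m) : omega G m ^ (m + 1) = 1 := by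
  refine eq_one_of_fix hG hm (omega_pow_apply_one _) fun p hp => ?_
  obtain ⟨i, j, x, hij, hx, rfl⟩ := adj_one_iff.mp hp
  rw [actsBy_omega_pow (m + 1) i j hij]
  simp

theorem ActsBy.perm_unique (hm : 1 < m) (hG : ∃ x : G, x ≠ 1) {F : GraphAut G m} {π π' f f'}
    (h1 : F 1 = 1) (H : ActsBy F π f) (H' : ActsBy F π' f') : π = π' := by
  obtain ⟨x, hx⟩ := hG
  refine Equiv.ext fun i => ?_
  obtain ⟨j, hji, -⟩ := exists_third hm i i
  obtain ⟨k, hki, hkj⟩ := exists_third hm i j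
  have hf : f x ≠ 1 := fun h => hx (H.injective hm (h.trans (H.map_one hm h1).symm))
  have key : ∀ t, i ≠ t → (π i = π' i ∧ π t = π' t) ∨ (π i = π' t ∧ π t = π' i) := fun t ht =>
    twoPt_support (π.injective.ne ht) (π'.injective.ne ht) hf ((H i t ht x).symm.trans (H' i t ht x))
  have n1 := π'.injective.ne hkj
  have e1 := key j hji.symm
  have e2 := key k hki.symm
  grind

/-- The homomorphism `D_{m+1} → Aut(𝒢_m(G))` with `r 1 ↦ ω` and `sr 0 ↦ τ`. -/
def dihedralHom (hG : ¬ ∀ a b : G, a * b = b * a) (hm : 1 < m) :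
    DihedralGroup (m + 1) →* GraphAut G m :=
  dihedralLift (omega G m) (tau G m) (omega_pow hG hm) tau_mul_tau tau_omega_tau

section

variable (hG : ¬ ∀ a b : G, a * b = b * a) (hm : 1 < m)

theorem dihedralHom_r (i : ZMod (m + 1)) :
    dihedralHom hG hm (.r i) = omega G m ^ i.val := rfl

theorem dihedralHom_sr (i : ZMod (m + 1)) :
    dihedralHom hG hm (.sr i) = tau G m * omega G m ^ i.val := rfl

theorem dihedralHom_r_one : dihedralHom hG hm (.r 1) = omega G m := by
  have : Fact (1 < m + 1) := ⟨by omega⟩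
  rw [dihedralHom_r, ZMod.val_one, pow_one]

theorem dihedralHom_sr_zero : dihedralHom hG hm (.sr 0) = tau G m := by
  rw [dihedralHom_sr, ZMod.val_zero, pow_zero, mul_one]

theorem range_dihedralHom : (dihedralHom hG hm).range = dihedralSubgroup G m := by
  apply le_antisymm
  · rintro _ ⟨i | i, rfl⟩
    · exact pow_mem omega_mem _
    · exact mul_mem tau_mem (pow_mem omega_mem _)
  · rw [dihedralSubgroup, Subgroup.closure_le]
    rintro F (rfl | rfl)
    · exact ⟨_, dihedralHom_sr_zero hG hm⟩
    · exact ⟨_, dihedralHom_r_one hG hm⟩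

theorem dihedralHom_apply_one (d : DihedralGroup (m + 1)) : dihedralHom hG hm d 1 = 1 := by
  rcases d with i | i
  · exact omega_pow_apply_one _
  · rw [dihedralHom_sr, RelIso.mul_apply, omega_pow_apply_one, tau_one_apply]

theorem exists_ne_one (hG : ¬ ∀ a b : G, a * b = b * a) : ∃ x : G, x ≠ 1 := by
  obtain ⟨u, -, -, hu, -⟩ := exists_two_avoiding hG 1 1
  exact ⟨u, hu⟩

theorem dihedral_eq_one_of_mem_range {d : DihedralGroup (m + 1)}
    (hd : dihedralHom hG hm d ∈ (coordAut G m).range) : d = 1 := by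
  obtain ⟨φ, hφ⟩ := hd
  have hA := actsBy_coordAut (m := m) φ
  rw [hφ] at hA
  have h1 := dihedralHom_apply_one hG hm d
  have uniq := fun {π f} (H : ActsBy (dihedralHom hG hm d) π f) =>
    H.perm_unique hm (exists_ne_one hG) h1 hA
  rcases d with i | i
  · have h := congrArg (· 0) (uniq (actsBy_omega_pow i.val))
    have h' : (0 : Fin (m + 1)) - Fin.ofNat (m + 1) i.val = 0 := h
    have e : Fin.ofNat (m + 1) i.val = i := Fin.ofNat_val_eq_self (n := m + 1) i
    rw [e] at h'
    have : i = 0 := sub_eq_zero.mp h' |>.symm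
    rw [this]
    rfl
  · exfalso
    have h := uniq ((actsBy_omega_pow i.val).mul actsBy_tau)
    have key : ∀ t : Fin (m + 1), Fin.rev (t - Fin.ofNat (m + 1) i.val) = t := fun t =>
      congrArg (· t) h
    generalize Fin.ofNat (m + 1) i.val = j at key
    -- For a reflection, the place `j` forces `j` to be the last place, and `j + 1` then forces the
    -- last but one place to be 0, that is `m ≤ 1`.
    have k1 := key j
    have k2 := key (j + 1)
    rw [sub_self, Fin.rev_zero] at k1
    rw [← k1, add_sub_cancel_left, Fin.last_add_one] at k2
    have := congrArg Fin.val k2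
    rw [Fin.val_rev, Fin.val_one', Fin.val_zero, Nat.mod_eq_of_lt (by omega)] at this
    omega

theorem coordAut_injective (hm : 1 < m) : Function.Injective (coordAut G m) := by
  intro f f' h
  refine MulEquiv.ext fun x => ?_
  have := congrFun (congrArg DFunLike.coe h) (fun _ => x)
  exact congrFun this ⟨0, by omega⟩

/-! ### The decomposition of the automorphism group -/

theorem coordAut_mul_omega (f : MulAut G) :
    coordAut G m f * omega G m = omega G m * coordAut G m f := by
  refine RelIso.ext fun g => diff_injective (funext fun i => ?_)
  change diff (coordAction G m f (omegaFun g)) i = diff (omegaFun (coordAction G m f g)) i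
  rw [diff_coordAction, diff_omegaFun, diff_omegaFun, diff_coordAction]

theorem coordAut_mul_tau (f : MulAut G) :
    coordAut G m f * tau G m = tau G m * coordAut G m f := by
  refine RelIso.ext fun g => diff_injective (funext fun i => ?_)
  change diff (coordAction G m f (tauFun g)) i = diff (tauFun (coordAction G m f g)) i
  rw [diff_coordAction, diff_tauFun, diff_tauFun, diff_coordAction, map_inv]

theorem commute_dihedral (f : MulAut G) {d : GraphAut G m} (hd : d ∈ dihedralSubgroup G m) :
    Commute (coordAut G m f) d := by
  have : dihedralSubgroup G m ≤ Subgroup.centralizer {coordAut G m f} := by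
    rw [dihedralSubgroup, Subgroup.closure_le]
    rintro F (rfl | rfl)
    · exact Subgroup.mem_centralizer_singleton_iff.mpr (coordAut_mul_tau f).symm
    · exact Subgroup.mem_centralizer_singleton_iff.mpr (coordAut_mul_omega f).symm
  exact (Subgroup.mem_centralizer_singleton_iff.mp (this hd)).symm

theorem coordAut_mul_translation (f : MulAut G) (a : Fin m → G) :
    coordAut G m f * translation G m a =
      translation G m (coordAction G m f a) * coordAut G m f := by
  refine RelIso.ext fun g => ?_
  change coordAction G m f (g * a⁻¹) = coordAction G m f g * (coordAction G m f a)⁻¹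
  rw [map_mul, map_inv]

theorem tau_mul_translation (a : Fin m → G) :
    tau G m * translation G m a = translation G m (tauFun a) * tau G m :=
  RelIso.ext fun _ => rfl

/-- An inner automorphism appears, from moving the first coordinate past `g`. Hence the argument
normalises `T ⋊ Aut(G)` by `Δ`, rather than `T` alone. -/
theorem omega_mul_translation (a : Fin m → G) :
    omega G m * translation G m a = translation G m (omegaFun a⁻¹)⁻¹ *
      coordAut G m (MulAut.conj (prolong a⁻¹ 0)⁻¹) * omega G m := by
  have pm : ∀ (g h : Fin m → G) t, prolong (g * h) t = prolong g t * prolong h t :=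
    fun g h t => path_mul g h (t + 1)
  refine RelIso.ext fun g => funext fun i => ?_
  change (prolong (g * a⁻¹) 0)⁻¹ * prolong (g * a⁻¹) (i + 1) =
    MulAut.conj (prolong a⁻¹ 0)⁻¹ ((prolong g 0)⁻¹ * prolong g (i + 1)) *
      ((prolong a⁻¹ 0)⁻¹ * prolong a⁻¹ (i + 1))⁻¹⁻¹
  rw [pm, pm, MulAut.conj_apply]
  group

variable (G m) in
/-- The homomorphism `G ^ m ⋊ Aut(G) → Aut(𝒢_m(G))`. -/
def affineHom : ((Fin m → G) ⋊[coordAction G m] MulAut G) →* GraphAut G m :=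
  SemidirectProduct.lift (translation G m) (coordAut G m) fun f => MonoidHom.ext fun a => by
    change translation G m (coordAction G m f a) =
      coordAut G m f * translation G m a * (coordAut G m f)⁻¹
    rw [coordAut_mul_translation, mul_inv_cancel_right]

theorem affineHom_apply (n : (Fin m → G) ⋊[coordAction G m] MulAut G) :
    affineHom G m n = translation G m n.left * coordAut G m n.right := rfl

theorem translation_mul_coordAut_mem (a : Fin m → G) (f : MulAut G) :
    translation G m a * coordAut G m f ∈ (affineHom G m).range := ⟨⟨a, f⟩, rfl⟩

theorem range_affineHom :
    (affineHom G m).range = translationGroup G m ⊔ (coordAut G m).range := by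
  apply le_antisymm
  · rintro _ ⟨n, rfl⟩
    exact mul_mem (Subgroup.mem_sup_left ⟨_, rfl⟩) (Subgroup.mem_sup_right ⟨_, rfl⟩)
  · refine sup_le ?_ ?_
    · rintro _ ⟨a, rfl⟩
      simpa using translation_mul_coordAut_mem a (1 : MulAut G)
    · rintro _ ⟨f, rfl⟩
      simpa using translation_mul_coordAut_mem (1 : Fin m → G) f

/-- The value at the identity isolates `a`; the induced permutation of places then isolates `d`.
This is the source of all the trivial intersections and injectivity statements about products with
the dihedral part. -/
theorem eq_one_of_mul_eq_one {a : Fin m → G} {f : MulAut G} {d : DihedralGroup (m + 1)}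
    (h : translation G m a * coordAut G m f * dihedralHom hG hm d = 1) :
    a = 1 ∧ f = 1 ∧ d = 1 := by
  have ha : a = 1 := by
    have := congrFun (congrArg DFunLike.coe h) 1
    rw [RelIso.mul_apply, RelIso.mul_apply, dihedralHom_apply_one, coordAut_one_apply,
      translation_apply, one_mul] at this
    exact inv_eq_one.mp this
  subst ha
  rw [map_one, one_mul] at h
  have hd : d = 1 := by
    refine dihedral_eq_one_of_mem_range hG hm ⟨f⁻¹, ?_⟩
    rw [map_inv]
    exact inv_eq_of_mul_eq_one_right h
  subst hd
  rw [map_one, mul_one] at h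
  exact ⟨rfl, coordAut_injective hm (h.trans (map_one _).symm), rfl⟩

theorem exists_eq_coordAut_mul {F : GraphAut G m} (h1 : F 1 = 1) :
    ∃ f d, F = coordAut G m f * dihedralHom hG hm d := by
  obtain ⟨d, hd, f, hf⟩ := exists_dihedral_mul_mem hG hm h1
  obtain ⟨e, he⟩ := (range_dihedralHom hG hm).ge hd
  refine ⟨f, e⁻¹, ?_⟩
  have hc := commute_dihedral f (inv_mem hd)
  rw [map_inv, he, hc.eq, hf, inv_mul_cancel_left]

theorem exists_eq_mul (F : GraphAut G m) :
    ∃ a f d, F = translation G m a * coordAut G m f * dihedralHom hG hm d := by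
  obtain ⟨f, d, h⟩ := exists_eq_coordAut_mul hG hm (F := translation G m (F 1) * F) (by
    rw [RelIso.mul_apply, translation_apply, mul_inv_cancel])
  refine ⟨(F 1)⁻¹, f, d, ?_⟩
  rw [mul_assoc, ← h, map_inv, inv_mul_cancel_left]

theorem dihedralHom_conj_mem (d : DihedralGroup (m + 1)) {x : GraphAut G m}
    (hx : x ∈ (affineHom G m).range) :
    dihedralHom hG hm d * x * (dihedralHom hG hm d)⁻¹ ∈ (affineHom G m).range := by
  have hτ : ∀ x ∈ (affineHom G m).range, tau G m * x * (tau G m)⁻¹ ∈ (affineHom G m).range := by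
    rintro _ ⟨n, rfl⟩
    rw [affineHom_apply, ← mul_assoc, tau_mul_translation, mul_assoc _ (tau G m),
      ← coordAut_mul_tau, ← mul_assoc, mul_inv_cancel_right]
    exact translation_mul_coordAut_mem _ _
  have hω : ∀ x ∈ (affineHom G m).range, omega G m * x * (omega G m)⁻¹ ∈ (affineHom G m).range := by
    rintro _ ⟨n, rfl⟩
    rw [affineHom_apply, ← mul_assoc, omega_mul_translation, mul_assoc _ (omega G m),
      ← coordAut_mul_omega, ← mul_assoc, mul_inv_cancel_right, mul_assoc, ← map_mul]
    exact translation_mul_coordAut_mem _ _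
  have hωk : ∀ (k : ℕ), ∀ x ∈ (affineHom G m).range,
      omega G m ^ k * x * (omega G m ^ k)⁻¹ ∈ (affineHom G m).range := by
    intro k
    induction k with
    | zero => intro x hx; simpa using hx
    | succ k ih =>
      intro x hx
      have := hω _ (ih x hx)
      rw [pow_succ', mul_inv_rev]
      simpa only [mul_assoc] using this
  rcases d with i | i
  · exact hωk _ x hx
  · have := hτ _ (hωk i.val x hx)
    rw [dihedralHom_sr, mul_inv_rev]
    simpa only [mul_assoc] using this

theorem range_affineHom_normal (hG : ¬ ∀ a b : G, a * b = b * a) (hm : 1 < m) :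
    (affineHom G m).range.Normal := by
  refine ⟨fun x hx F => ?_⟩
  obtain ⟨a, f, d, rfl⟩ := exists_eq_mul hG hm F
  have h1 := dihedralHom_conj_mem hG hm d hx
  have h2 := translation_mul_coordAut_mem a f
  have := mul_mem (mul_mem h2 h1) (inv_mem h2)
  rw [mul_inv_rev]
  simpa only [mul_assoc, mul_inv_rev] using this

/-- Intervals are the lines through the identity, without the identity itself. Preserving each of
them means that `π` preserves every pair of places, and with at least three places this leaves `π =
1`. -/
theorem homogeneousAut_eq_range (hG : ¬ ∀ a b : G, a * b = b * a) (hm : 1 < m) :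
    homogeneousAut G m = (coordAut G m).range := by
  apply le_antisymm
  · rintro F ⟨h1, hF⟩
    obtain ⟨π, f, H⟩ := exists_actsBy hG hm h1
    obtain ⟨x, hx⟩ := exists_ne_one hG
    have hfx : f x ≠ 1 := fun h => hx (H.injective hm (h.trans (H.map_one hm h1).symm))
    have line : ∀ i j, i < j → (π i = i ∧ π j = j) ∨ (π i = j ∧ π j = i) := by
      intro i j hij
      have hmem : twoPt i j x ∈ interval G m i j := ⟨x, hx, by simp [twoPt, hij]⟩
      have := Set.mem_image_of_mem F hmem
      rw [hF i j hij (by omega)] at this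
      obtain ⟨y, hy, e⟩ := this
      have e' : twoPt (π i) (π j) (f x) = (twoPt i j y : Fin m → G) := by
        rw [← H i j hij.ne, e]
        simp [twoPt, hij]
      exact twoPt_support (π.injective.ne hij.ne) hij.ne hfx e'
    have line' : ∀ i j, i ≠ j → (π i = i ∧ π j = j) ∨ (π i = j ∧ π j = i) := by
      intro i j hij
      rcases hij.lt_or_gt with h | h
      · exact line i j h
      · exact (line j i h).imp And.symm And.symm
    have hπ : π = 1 := by
      refine Equiv.ext fun i => ?_
      obtain ⟨j, hji, -⟩ := exists_third hm i i
      obtain ⟨k, hki, hkj⟩ := exists_third hm i j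
      have e1 := line' i j hji.symm
      have e2 := line' i k hki.symm
      change π i = i
      grind
    subst hπ
    exact H.mem_range_coordAut hG hm h1
  · rintro _ ⟨f, rfl⟩
    refine ⟨coordAut_one_apply f, fun k l hkl hl => ?_⟩
    have hb : ∀ (f : MulAut G) x, coordAut G m f (block m k l x) = block m k l (f x) := by
      intro f x
      funext i
      simp only [coordAut_apply, block]
      split_ifs <;> simp
    ext g
    constructor
    · rintro ⟨_, ⟨x, hx, rfl⟩, rfl⟩
      exact ⟨f x, by simpa using hx, hb f x⟩
    · rintro ⟨x, hx, rfl⟩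
      exact ⟨block m k l (f⁻¹ x), ⟨f⁻¹ x, by simpa using hx, rfl⟩, by rw [hb]; simp⟩

end

/-! ### The abstract isomorphisms and the internal products -/

section

variable (hG : ¬ ∀ a b : G, a * b = b * a) (hm : 1 < m)

theorem affineHom_injective (hG : ¬ ∀ a b : G, a * b = b * a) (hm : 1 < m) :
    Function.Injective (affineHom G m) := by
  refine (injective_iff_map_eq_one _).mpr fun n hn => ?_
  rw [affineHom_apply] at hn
  obtain ⟨h1, h2, -⟩ := eq_one_of_mul_eq_one hG hm (a := n.left) (f := n.right)
    (d := 1) (by rw [map_one, mul_one, hn])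
  exact SemidirectProduct.ext h1 h2

/-- The action of `D_{m+1}` on `G ^ m ⋊ Aut(G)` by conjugation inside `Aut(𝒢_m(G))`. -/
noncomputable def dihedralAction :
    DihedralGroup (m + 1) →* MulAut ((Fin m → G) ⋊[coordAction G m] MulAut G) :=
  have := range_affineHom_normal hG hm
  (MulAut.congr (MonoidHom.ofInjective (affineHom_injective hG hm)).symm).toMonoidHom.comp
    ((MulAut.conjNormal (H := (affineHom G m).range)).comp (dihedralHom hG hm))

theorem affineHom_dihedralAction (d : DihedralGroup (m + 1))
    (n : (Fin m → G) ⋊[coordAction G m] MulAut G) :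
    affineHom G m (dihedralAction hG hm d n) =
      dihedralHom hG hm d * affineHom G m n * (dihedralHom hG hm d)⁻¹ := by
  have := range_affineHom_normal hG hm
  set e := MonoidHom.ofInjective (affineHom_injective hG hm)
  have he : ∀ y, affineHom G m (e.symm y) = y := fun y =>
    congrArg Subtype.val (e.apply_symm_apply y)
  exact he (MulAut.conjNormal (dihedralHom hG hm d) (e n))

/-- The homomorphism `(G ^ m ⋊ Aut(G)) ⋊ D_{m+1} → Aut(𝒢_m(G))`. -/
noncomputable def fullHom :
    (((Fin m → G) ⋊[coordAction G m] MulAut G) ⋊[dihedralAction hG hm] DihedralGroup (m + 1)) →*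
      GraphAut G m :=
  SemidirectProduct.lift (affineHom G m) (dihedralHom hG hm) fun d =>
    MonoidHom.ext fun n => affineHom_dihedralAction hG hm d n

theorem fullHom_inl (n : (Fin m → G) ⋊[coordAction G m] MulAut G) :
    fullHom hG hm (SemidirectProduct.inl n) = affineHom G m n :=
  SemidirectProduct.lift_inl _ _ _ _

theorem fullHom_inr (d : DihedralGroup (m + 1)) :
    fullHom hG hm (SemidirectProduct.inr d) = dihedralHom hG hm d :=
  SemidirectProduct.lift_inr _ _ _ _

theorem fullHom_bijective : Function.Bijective (fullHom hG hm) := by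
  constructor
  · refine (injective_iff_map_eq_one _).mpr fun n hn => ?_
    -- By definition `fullHom` sends `n` to the product of its three components, so `hn` already has
    -- the required form.
    obtain ⟨h1, h2, h3⟩ := eq_one_of_mul_eq_one hG hm (a := n.left.left) (f := n.left.right)
      (d := n.right) hn
    exact SemidirectProduct.ext (SemidirectProduct.ext h1 h2) h3
  · intro F
    obtain ⟨a, f, d, rfl⟩ := exists_eq_mul hG hm F
    exact ⟨⟨⟨a, f⟩, d⟩, rfl⟩

/-- The homomorphism from `Aut(G) × D_{m+1}` to the stabilizer of the identity. -/
noncomputable def stabilizerHom :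
    MulAut G × DihedralGroup (m + 1) →* MulAction.stabilizer (GraphAut G m) (1 : Fin m → G) :=
  (MonoidHom.noncommCoprod (coordAut G m) (dihedralHom hG hm) fun f d =>
    commute_dihedral f ((range_dihedralHom hG hm).le ⟨d, rfl⟩)).codRestrict _ fun x => by
      change (coordAut G m x.1 * dihedralHom hG hm x.2) 1 = 1
      rw [RelIso.mul_apply, dihedralHom_apply_one, coordAut_one_apply]

theorem coe_stabilizerHom (x : MulAut G × DihedralGroup (m + 1)) :
    (stabilizerHom hG hm x : GraphAut G m) = coordAut G m x.1 * dihedralHom hG hm x.2 := rfl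

theorem stabilizerHom_bijective : Function.Bijective (stabilizerHom hG hm) := by
  constructor
  · refine (injective_iff_map_eq_one _).mpr fun x hx => ?_
    have hx' := congrArg Subtype.val hx
    rw [coe_stabilizerHom] at hx'
    obtain ⟨-, h2, h3⟩ := eq_one_of_mul_eq_one hG hm (a := 1) (f := x.1) (d := x.2) (by
      rw [map_one, one_mul]
      exact hx')
    exact Prod.ext h2 h3
  · rintro ⟨F, hF⟩
    obtain ⟨f, d, rfl⟩ := exists_eq_coordAut_mul hG hm (F := F) hF
    exact ⟨(f, d), rfl⟩

theorem isInternalDirect_stabilizer (hG : ¬ ∀ a b : G, a * b = b * a) (hm : 1 < m) :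
    IsInternalDirect (coordAut G m).range (dihedralSubgroup G m)
      (MulAction.stabilizer (GraphAut G m) (1 : Fin m → G)) := by
  refine ⟨?_, ?_, ?_⟩
  · rintro _ ⟨f, rfl⟩ d hd
    exact commute_dihedral f hd
  · rw [eq_bot_iff]
    rintro x ⟨hx, hd⟩
    obtain ⟨d, rfl⟩ := (range_dihedralHom hG hm).ge hd
    rw [dihedral_eq_one_of_mem_range hG hm hx, map_one]
    exact one_mem _
  · apply le_antisymm
    · refine sup_le ?_ ?_
      · rintro _ ⟨f, rfl⟩
        exact coordAut_one_apply f
      · rw [← range_dihedralHom hG hm]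
        rintro _ ⟨d, rfl⟩
        exact dihedralHom_apply_one hG hm d
    · intro F hF
      obtain ⟨f, d, rfl⟩ := exists_eq_coordAut_mul hG hm (F := F) hF
      exact mul_mem (Subgroup.mem_sup_left ⟨f, rfl⟩)
        (Subgroup.mem_sup_right ((range_dihedralHom hG hm).le ⟨d, rfl⟩))

theorem isInternalSemidirect_translationGroup :
    IsInternalSemidirect (translationGroup G m) (coordAut G m).range
      (translationGroup G m ⊔ (coordAut G m).range) := by
  refine ⟨?_, ?_, rfl⟩
  · rw [← range_affineHom]
    rintro _ ⟨⟨a, f⟩, rfl⟩ _ ⟨b, rfl⟩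
    refine ⟨a * coordAction G m f b * a⁻¹, ?_⟩
    rw [affineHom_apply, mul_inv_rev, mul_assoc (translation G m a), coordAut_mul_translation,
      map_mul, map_mul, map_inv]
    group
  · rw [eq_bot_iff]
    rintro _ ⟨⟨a, rfl⟩, f, hf⟩
    have h := congrFun (congrArg DFunLike.coe hf) 1
    rw [coordAut_one_apply, translation_apply, one_mul] at h
    rw [inv_eq_one.mp h.symm, map_one]
    exact one_mem _

theorem isInternalSemidirect_dihedralSubgroup
    (hG : ¬ ∀ a b : G, a * b = b * a) (hm : 1 < m) :
    IsInternalSemidirect (translationGroup G m ⊔ (coordAut G m).range) (dihedralSubgroup G m) ⊤ := by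
  rw [← range_affineHom, ← range_dihedralHom hG hm]
  refine ⟨fun F _ n hn => (range_affineHom_normal hG hm).conj_mem n hn F, ?_, ?_⟩
  · rw [eq_bot_iff]
    rintro _ ⟨⟨n, hn⟩, d, rfl⟩
    obtain ⟨-, -, h⟩ := eq_one_of_mul_eq_one hG hm (a := n.left) (f := n.right) (d := d⁻¹) (by
      rw [← affineHom_apply, hn, map_inv, mul_inv_cancel])
    rw [inv_eq_one.mp h, map_one]
    exact one_mem _
  · rw [eq_top_iff]
    intro F _
    obtain ⟨a, f, d, rfl⟩ := exists_eq_mul hG hm F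
    exact mul_mem (Subgroup.mem_sup_left (translation_mul_coordAut_mem a f))
      (Subgroup.mem_sup_right ⟨d, rfl⟩)

end

end GenericCayley

open GenericCayley in
/-- The automorphism group of `𝒢_m(G)` for a finite non-abelian group `G` and `m > 1`.
In the conventions of `DihedralGroup (m + 1)`, `r 1` is a rotation of order `m + 1` and
`sr 0` is a reflection. -/
theorem theorem6p10 {G : Type*} [Group G] [Finite G] (hG : ¬ ∀ a b : G, a * b = b * a)
    (m : ℕ) (hm : 1 < m) :
    -- the homogeneous automorphisms are those induced by automorphisms of `G`
    homogeneousAut G m = (coordAut G m).range ∧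
    -- the stabilizer of the identity, as an internal direct product
    IsInternalDirect (homogeneousAut G m) (dihedralSubgroup G m)
      (MulAction.stabilizer (GraphAut G m) (1 : Fin m → G)) ∧
    (∃ Ψ : MulAut G × DihedralGroup (m + 1) ≃*
        MulAction.stabilizer (GraphAut G m) (1 : Fin m → G),
      (∀ f : MulAut G, (Ψ (f, 1) : GraphAut G m) = coordAut G m f) ∧
      (Ψ (1, DihedralGroup.r 1) : GraphAut G m) = omega G m ∧
      (Ψ (1, DihedralGroup.sr 0) : GraphAut G m) = tau G m) ∧
    -- the full automorphism group, as a two-step internal semidirect product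
    IsInternalSemidirect (translationGroup G m) (homogeneousAut G m)
      (translationGroup G m ⊔ homogeneousAut G m) ∧
    IsInternalSemidirect (translationGroup G m ⊔ homogeneousAut G m) (dihedralSubgroup G m) ⊤ ∧
    -- the corresponding abstract isomorphism
    (∃ (φ : DihedralGroup (m + 1) →* MulAut ((Fin m → G) ⋊[coordAction G m] MulAut G))
        (Φ : (((Fin m → G) ⋊[coordAction G m] MulAut G) ⋊[φ] DihedralGroup (m + 1)) ≃*
          GraphAut G m),
      (∀ a : Fin m → G, Φ (SemidirectProduct.inl (SemidirectProduct.inl a)) =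
        translation G m a) ∧
      (∀ f : MulAut G, Φ (SemidirectProduct.inl (SemidirectProduct.inr f)) = coordAut G m f) ∧
      Φ (SemidirectProduct.inr (DihedralGroup.r 1)) = omega G m ∧
      Φ (SemidirectProduct.inr (DihedralGroup.sr 0)) = tau G m) := by
  rw [homogeneousAut_eq_range hG hm]
  refine ⟨rfl, isInternalDirect_stabilizer hG hm,
    ⟨MulEquiv.ofBijective _ (stabilizerHom_bijective hG hm), fun f => ?_, ?_, ?_⟩,
    isInternalSemidirect_translationGroup, isInternalSemidirect_dihedralSubgroup hG hm,
    dihedralAction hG hm, MulEquiv.ofBijective _ (fullHom_bijective hG hm), fun a => ?_,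
    fun f => ?_, ?_, ?_⟩
  · exact (congrArg (coordAut G m f * ·) (map_one (dihedralHom hG hm))).trans (mul_one _)
  · exact (congrArg (coordAut G m 1 * ·) (dihedralHom_r_one hG hm)).trans (one_mul _)
  · exact (congrArg (coordAut G m 1 * ·) (dihedralHom_sr_zero hG hm)).trans (one_mul _)
  · exact (fullHom_inl hG hm _).trans (SemidirectProduct.lift_inl _ _ _ _)
  · exact (fullHom_inl hG hm _).trans (SemidirectProduct.lift_inr _ _ _ _)
  · exact (fullHom_inr hG hm _).trans (dihedralHom_r_one hG hm)
  · exact (fullHom_inr hG hm _).trans (dihedralHom_sr_zero hG hm)
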